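/- Let $A_0$ (resp. $A_1$) be the Banach space of all complex matrices $a=(a_{ij})_{i,j\in\mathbb N}$ with $\|a\|_{A_0}=\sup_i\sum_j|a_{ij}|<\infty$ (resp. $\|a\|_{A_1}=\sup_j\sum_i|a_{ij}|<\infty$), both viewed inside the space of all matrices with entrywise convergence, and let $A_0^n$, $A_1^n$ be the corresponding spaces of $n\times n$ matrices. Identifying operators between sequence spaces with their matrices, one has isometrically $A_0^n=B(\ell_\infty^n,\ell_\infty^n)$, $A_1^n=B(\ell_1^n,\ell_1^n)$, $A_0=B(c_0,\ell_\infty)$ and $A_1=B(\ell_1,\ell_1)$, where $B(X,Y)$ is the space of bounded operators from $X$ to $Y$ with the operator norm. Let $B_r(\ell_p,\ell_p)$ be the space of regular operators on the complex space $\ell_p$, that is, of the operators $u$ for which there is a constant $C$ with $\big\|\sup_{k\le m}|u(x_k)|\big\|_p\le C\big\|\sup_{k\le m}|x_k|\big\|_p$ for all finite sequences $x_1,\dots,x_m$ in $\ell_p$, normed by the smallest such constant, $\|u\|_r$; $B_r(\ell_p^n,\ell_p^n)$ is defined likewise. For a compatible couple $(X_0,X_1)$ of complex Banach spaces and $0<\theta<1$,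 let $(X_0,X_1)_\theta$ and $(X_0,X_1)^\theta$ be the first and the second (upper) complex interpolation spaces of Calderón. Let $A_0^{1-\theta}A_1^\theta$ be the space of the matrices $a$ for which there are $b\in A_0$, $c\in A_1$ with $|a_{ij}|\le|b_{ij}|^{1-\theta}|c_{ij}|^\theta$ for all $i,j$, normed by the infimum of $\|b\|_{A_0}^{1-\theta}\|c\|_{A_1}^\theta$ over all such $b$, $c$. **Theorem 1.** Let $0<\theta<1$ and $p=1/\theta$. Then the following hold with equality of norms: (i) $(A_0^n,A_1^n)_\theta=B_r(\ell_p^n,\ell_p^n)$ for every integer $n\ge 0$; (ii) $A_0^{1-\theta}A_1^\theta=(A_0,A_1)^\theta=B_r(\ell_p,\ell_p)$. Moreover, the regular norm of an operator on $\ell_p$ or $\ell_p^n$ with matrix $(a_{ij})$ is the operator norm of the operator with matrix $(|a_{ij}|)$ (the former being infinite if and only if the latter operator is not bounded). -/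

import Mathlib

open scoped ENNReal NNReal ZeroAtInfty

noncomputable section

namespace RegInterp

/-! ## Complex interpolation of a compatible couple of Banach spaces -/

section Interpolation

variable {X₀ X₁ V : Type*} [NormedAddCommGroup X₀] [NormedSpace ℂ X₀] [CompleteSpace X₀]
  [NormedAddCommGroup X₁] [NormedSpace ℂ X₁] [CompleteSpace X₁]
  [AddCommGroup V] [Module ℂ V] [TopologicalSpace V] [IsTopologicalAddGroup V] [T2Space V]

/-- A compatible couple: two complex Banach spaces that are continuously and injectively embedded
in the same Hausdorff topological vector space `V`. -/
structure Couple (X₀ X₁ V : Type*) [NormedAddCommGroup X₀] [NormedSpace ℂ X₀] [CompleteSpace X₀]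
    [NormedAddCommGroup X₁] [NormedSpace ℂ X₁] [CompleteSpace X₁]
    [AddCommGroup V] [Module ℂ V] [TopologicalSpace V] [IsTopologicalAddGroup V] [T2Space V] where
  /-- the embedding of `X₀` -/
  emb₀ : X₀ →L[ℂ] V
  /-- the embedding of `X₁` -/
  emb₁ : X₁ →L[ℂ] V
  inj₀ : Function.Injective emb₀
  inj₁ : Function.Injective emb₁

namespace Couple

variable (c : Couple X₀ X₁ V)

/-- The map `(x₀, x₁) ↦ x₀ + x₁` into `V`, on the `ℓ₁`-direct sum of `X₀` and `X₁`. -/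
def addMap : WithLp 1 (X₀ × X₁) →L[ℂ] V :=
  (c.emb₀.coprod c.emb₁).comp
    (WithLp.prodContinuousLinearEquiv 1 ℂ X₀ X₁ : WithLp 1 (X₀ × X₁) →L[ℂ] X₀ × X₁)

/-- The pairs with `x₀ + x₁ = 0` in `V`. -/
def diag : Submodule ℂ (WithLp 1 (X₀ × X₁)) := LinearMap.ker c.addMap.toLinearMap

instance : IsClosed (c.diag : Set (WithLp 1 (X₀ × X₁))) := c.addMap.isClosed_ker

/-- The space `X₀ + X₁`, with the norm `‖x‖ = inf {‖x₀‖ + ‖x₁‖ : x = x₀ + x₁}`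
(this is the quotient norm). -/
abbrev Sum : Type _ := WithLp 1 (X₀ × X₁) ⧸ c.diag

/-- The inclusion `X₀ + X₁ ⊆ V`. -/
def toV : c.Sum →ₗ[ℂ] V := c.diag.liftQ c.addMap.toLinearMap le_rfl

/-- The inclusion `X₀ ⊆ X₀ + X₁`. -/
def inl (x : X₀) : c.Sum := Submodule.Quotient.mk (WithLp.toLp 1 (x, 0))

/-- The inclusion `X₁ ⊆ X₀ + X₁`. -/
def inr (x : X₁) : c.Sum := Submodule.Quotient.mk (WithLp.toLp 1 (0, x))

theorem toV_inl (x : X₀) : c.toV (c.inl x) = c.emb₀ x := by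
  simp [toV, inl, addMap]

theorem toV_inr (x : X₁) : c.toV (c.inr x) = c.emb₁ x := by
  simp [toV, inr, addMap]

theorem toV_injective : Function.Injective c.toV :=
  LinearMap.ker_eq_bot.1 (Submodule.ker_liftQ_eq_bot _ _ _ le_rfl)

/-- The closed strip `0 ≤ Re z ≤ 1`. -/
def strip : Set ℂ := {z | 0 ≤ z.re ∧ z.re ≤ 1}

/-- The open strip `0 < Re z < 1`. -/
def openStrip : Set ℂ := {z | 0 < z.re ∧ z.re < 1}

/-- `f` belongs to the space used in the first complex method, and its boundary values
`t ↦ f (it)` and `t ↦ f (1 + it)` are `f₀` and `f₁`, continuous functions into `X₀` and `X₁`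
which tend to `0` at infinity. -/
structure IsLowerRep (f : ℂ → c.Sum) (f₀ : C₀(ℝ, X₀)) (f₁ : C₀(ℝ, X₁)) : Prop where
  continuousOn : ContinuousOn f strip
  differentiableOn : DifferentiableOn ℂ f openStrip
  bounded : ∃ K : ℝ, ∀ z ∈ strip, ‖f z‖ ≤ K
  left : ∀ t : ℝ, f (t * Complex.I) = c.inl (f₀ t)
  right : ∀ t : ℝ, f (1 + t * Complex.I) = c.inr (f₁ t)

/-- The norm of `(X₀, X₁)_θ` (first complex method), as a function on `V`;
it is `∞` exactly off `(X₀, X₁)_θ`. -/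
def lowerENorm (θ : ℝ) (v : V) : ℝ≥0∞ :=
  ⨅ (f : ℂ → c.Sum) (f₀ : C₀(ℝ, X₀)) (f₁ : C₀(ℝ, X₁)) (_ : c.IsLowerRep f f₀ f₁)
    (_ : c.toV (f (θ : ℂ)) = v), max ‖f₀‖ₑ ‖f₁‖ₑ

/-- `g` belongs to the space used in the second complex method, with norm at most `M`:
the difference quotients of `g` on the lines `Re z = 0` and `Re z = 1` lie in the balls of
radius `M` of `X₀` and `X₁`. -/
structure IsUpperRep (g : ℂ → c.Sum) (M : ℝ≥0) : Prop where
  continuousOn : ContinuousOn g strip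
  differentiableOn : DifferentiableOn ℂ g openStrip
  growth : ∃ K : ℝ, ∀ z ∈ strip, ‖g z‖ ≤ K * (1 + ‖z‖)
  left : ∀ s t : ℝ, ∃ x : X₀,
    c.inl x = g (s * Complex.I) - g (t * Complex.I) ∧ ‖x‖ ≤ M * |s - t|
  right : ∀ s t : ℝ, ∃ x : X₁,
    c.inr x = g (1 + s * Complex.I) - g (1 + t * Complex.I) ∧ ‖x‖ ≤ M * |s - t|

/-- The norm of `(X₀, X₁)^θ` (second complex method), as a function on `V`;
it is `∞` exactly off `(X₀, X₁)^θ`. -/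
def upperENorm (θ : ℝ) (v : V) : ℝ≥0∞ :=
  ⨅ (g : ℂ → c.Sum) (M : ℝ≥0) (_ : c.IsUpperRep g M) (_ : c.toV (deriv g (θ : ℂ)) = v),
    (M : ℝ≥0∞)

end Couple

end Interpolation

/-! ## Spaces of matrices -/

section Matrices

variable {ι : Type*}

/-- `sup_i ∑_j |a_ij|`. -/
def rowENorm (a : Matrix ι ι ℂ) : ℝ≥0∞ := ⨆ i, ∑' j, ‖a i j‖ₑ

/-- `sup_j ∑_i |a_ij|`. -/
def colENorm (a : Matrix ι ι ℂ) : ℝ≥0∞ := ⨆ j, ∑' i, ‖a i j‖ₑ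

/-- The scalar sequence space `ℓ_p` over the index set `ι`. -/
abbrev ell (ι : Type*) (p : ℝ≥0∞) : Type _ := lp (fun _ : ι => ℂ) p

/-- The bounded families of elements of `ℓ_1`, with the supremum norm. It is the Banach space of
the matrices `a` with `sup_i ∑_j |a_ij| < ∞` (a matrix is the family of its rows), and also that
of the matrices with `sup_j ∑_i |a_ij| < ∞` (a matrix is the family of its columns). -/
abbrev Families (ι : Type*) : Type _ := lp (fun _ : ι => ell ι 1) ∞

theorem continuous_entry (i j : ι) : Continuous fun x : Families ι => (x i : ι → ℂ) j :=
  ((lp.lipschitzWith_one_eval (E := fun _ : ι => ℂ) 1 j).continuous).comp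
    ((lp.lipschitzWith_one_eval (E := fun _ : ι => ell ι 1) ∞ i).continuous)

/-- The matrix with the given rows. -/
def ofRows : Families ι →L[ℂ] Matrix ι ι ℂ where
  toFun x := Matrix.of fun i j => (x i : ι → ℂ) j
  map_add' _ _ := rfl
  map_smul' _ _ := rfl
  cont := continuous_pi fun i => continuous_pi fun j => continuous_entry i j

/-- The matrix with the given columns. -/
def ofCols : Families ι →L[ℂ] Matrix ι ι ℂ where
  toFun x := Matrix.of fun i j => (x j : ι → ℂ) i
  map_add' _ _ := rfl
  map_smul' _ _ := rfl
  cont := continuous_pi fun i => continuous_pi fun j => continuous_entry j i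

variable (ι) in
/-- The couple `(A₀, A₁)` of spaces of complex matrices, inside the space of all matrices with
the topology of entrywise convergence: `A₀` has the norm `sup_i ∑_j |a_ij|`, and `A₁` has the norm
`sup_j ∑_i |a_ij|`. -/
def matrixCouple : Couple (Families ι) (Families ι) (Matrix ι ι ℂ) where
  emb₀ := ofRows
  emb₁ := ofCols
  inj₀ x y h := by
    refine lp.ext (funext fun i => lp.ext (funext fun j => ?_))
    exact congrFun (congrFun h i) j
  inj₁ x y h := by
    refine lp.ext (funext fun i => lp.ext (funext fun j => ?_))
    exact congrFun (congrFun h j) i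

theorem enorm_ell_one (y : ell ι 1) : ‖y‖ₑ = ∑' j, ‖(y : ι → ℂ) j‖ₑ := by
  have hs : Summable fun j => ‖(y : ι → ℂ) j‖ := by
    simpa using (lp.memℓp y).summable (by simp)
  have h : ‖y‖ = ∑' j, ‖(y : ι → ℂ) j‖ := by
    simpa using lp.norm_eq_tsum_rpow (p := 1) (by simp) y
  rw [← ofReal_norm, h, ENNReal.ofReal_tsum_of_nonneg (fun _ => norm_nonneg _) hs]
  simp only [ofReal_norm]

theorem enorm_families (x : Families ι) : ‖x‖ₑ = ⨆ i, ‖x i‖ₑ := by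
  refine le_antisymm ?_ (iSup_le fun i => ?_)
  · rcases eq_or_ne (⨆ i, ‖x i‖ₑ) ∞ with h | h
    · rw [h]; exact le_top
    · rw [← ofReal_norm]
      refine ENNReal.ofReal_le_of_le_toReal (lp.norm_le_of_forall_le ENNReal.toReal_nonneg ?_)
      intro i
      rw [← toReal_enorm]
      exact ENNReal.toReal_mono h (le_iSup (fun i => ‖x i‖ₑ) i)
  · rw [← ofReal_norm, ← ofReal_norm]
    exact ENNReal.ofReal_le_ofReal (lp.norm_apply_le_norm (by simp) x i)

/-- The norm of `A₀` is `sup_i ∑_j |a_ij|`. -/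
theorem enorm_rows (x : Families ι) : ‖x‖ₑ = rowENorm (ofRows x) := by
  simp only [enorm_families, enorm_ell_one]; rfl

/-- The norm of `A₁` is `sup_j ∑_i |a_ij|`. -/
theorem enorm_cols (x : Families ι) : ‖x‖ₑ = colENorm (ofCols x) := by
  simp only [enorm_families, enorm_ell_one]; rfl

/-- `A₀` consists of the matrices with `sup_i ∑_j |a_ij| < ∞`. -/
theorem mem_rows (a : Matrix ι ι ℂ) : (∃ x, ofRows x = a) ↔ rowENorm a ≠ ∞ := by
  constructor
  · rintro ⟨x, rfl⟩
    rw [← enorm_rows]; simp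
  · intro h
    have hi : ∀ i, ∑' j, ‖a i j‖ₑ ≠ ∞ := fun i =>
      ne_top_of_le_ne_top h (le_iSup (fun i => ∑' j, ‖a i j‖ₑ) i)
    have hm : ∀ i, Memℓp (a i) 1 := fun i => by
      refine memℓp_gen ?_
      have := ENNReal.summable_toReal (hi i)
      simpa using this
    have hb : Memℓp (fun i => (⟨a i, hm i⟩ : ell ι 1)) ∞ := by
      refine memℓp_infty ⟨(rowENorm a).toReal, ?_⟩
      rintro _ ⟨i, rfl⟩
      dsimp only
      rw [← toReal_enorm, enorm_ell_one]
      exact ENNReal.toReal_mono h (le_iSup (fun i => ∑' j, ‖a i j‖ₑ) i)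
    exact ⟨⟨_, hb⟩, rfl⟩

/-- `A₁` consists of the matrices with `sup_j ∑_i |a_ij| < ∞`. -/
theorem mem_cols (a : Matrix ι ι ℂ) : (∃ x, ofCols x = a) ↔ colENorm a ≠ ∞ := by
  refine Iff.trans ⟨?_, ?_⟩ (mem_rows a.transpose)
  · rintro ⟨x, rfl⟩
    exact ⟨x, rfl⟩
  · rintro ⟨x, hx⟩
    exact ⟨x, by rw [← a.transpose_transpose, ← hx]; rfl⟩

variable (ι) in
/-- The norm of the Calderón product `A₀^{1-θ} A₁^θ`, as a function on the space of all matrices;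
it is `∞` exactly off `A₀^{1-θ} A₁^θ`. -/
def productENorm (θ : ℝ) (a : Matrix ι ι ℂ) : ℝ≥0∞ :=
  ⨅ (b₀ : Families ι) (b₁ : Families ι)
    (_ : ∀ i j, ‖a i j‖ ≤ ‖ofRows b₀ i j‖ ^ (1 - θ) * ‖ofCols b₁ i j‖ ^ θ),
    ENNReal.ofReal (‖b₀‖ ^ (1 - θ) * ‖b₁‖ ^ θ)

end Matrices

/-! ## Operators on sequence spaces, and their matrices -/

section Operators

/-- `a` is the matrix of the operator `u` between two spaces of scalar sequences (`cE` and `cF`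
send an element to its sequence of coordinates): `(u x)_i = ∑_j a_ij x_j`. -/
def IsMatrixOf {ι κ E F : Type*} (cE : E → ι → ℂ) (cF : F → κ → ℂ) (u : E → F)
    (a : Matrix κ ι ℂ) : Prop :=
  ∀ x i, HasSum (fun j => a i j * cE x j) (cF (u x) i)

/-- The space of the operators `u` from `E` to `F` with `N u < ∞`, normed by `N`, is the space of
the matrices `a` with `M a < ∞`, normed by `M`, each operator being identified with its matrix. -/
structure IsometricIdentity {ι κ E F : Type*} [NormedAddCommGroup E] [NormedSpace ℂ E]
    [NormedAddCommGroup F] [NormedSpace ℂ F] (cE : E → ι → ℂ) (cF : F → κ → ℂ)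
    (N : (E →L[ℂ] F) → ℝ≥0∞) (M : Matrix κ ι ℂ → ℝ≥0∞) : Prop where
  matrix : ∀ u, N u ≠ ∞ → ∃! a, IsMatrixOf cE cF u a
  operator : ∀ a, M a ≠ ∞ → ∃! u : E →L[ℂ] F, IsMatrixOf cE cF u a
  norm_eq : ∀ (u : E →L[ℂ] F) a, IsMatrixOf cE cF u a → N u = M a

variable {ι : Type*} {p : ℝ≥0∞}

/-- The sequence of coordinates of an element of `ℓ_p`. -/
def coords (x : ell ι p) : ι → ℂ := fun i => x i

/-- The sequence of coordinates of an element of `c_0`. -/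
def coordsZero (x : C₀(ℕ, ℂ)) : ℕ → ℂ := fun i => x i

/-- `sup_k |x_k|` for a finite sequence `x` in `ℓ_p`, an element of the real space `ℓ_p`. -/
def supAbs {m : ℕ} (x : Fin m → ell ι p) : lp (fun _ : ι => ℝ) p :=
  ⟨fun i => ⨆ k, ‖x k i‖, by
    have hf : ∀ k, Memℓp (fun i => ‖x k i‖) p := fun k => memℓp_norm_iff.2 (lp.memℓp (x k))
    refine (Memℓp.finsetSum Finset.univ (f := fun k i => ‖x k i‖) fun k _ => hf k).mono
      (f := fun i => ⨆ k, ‖x k i‖) fun i => ?_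
    rw [Real.norm_of_nonneg (Real.iSup_nonneg fun k => norm_nonneg _)]
    exact Real.iSup_le (fun k => Finset.single_le_sum (f := fun k => ‖x k i‖)
      (fun _ _ => norm_nonneg _) (Finset.mem_univ k))
      (Finset.sum_nonneg fun _ _ => norm_nonneg _)⟩

variable [Fact (1 ≤ p)]

/-- `‖sup_k |u x_k|‖ ≤ C ‖sup_k |x_k|‖` for all finite sequences `x`. -/
def IsRegularBound (u : ell ι p →L[ℂ] ell ι p) (C : ℝ≥0) : Prop :=
  ∀ (m : ℕ) (x : Fin m → ell ι p), ‖supAbs fun k => u (x k)‖ ≤ C * ‖supAbs x‖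

/-- The regular norm of an operator on `ℓ_p`, equal to `∞` exactly for the operators that are not
regular: the smallest `C` with `‖sup_k |u x_k|‖ ≤ C ‖sup_k |x_k|‖` for all finite sequences. -/
def regENorm (u : ell ι p →L[ℂ] ell ι p) : ℝ≥0∞ :=
  ⨅ (C : ℝ≥0) (_ : IsRegularBound u C), (C : ℝ≥0∞)

variable (p) in
/-- The norm of the operator on `ℓ_p` with matrix `a`, equal to `∞` if there is no such bounded
operator. -/
def opENorm (a : Matrix ι ι ℂ) : ℝ≥0∞ :=
  ⨅ (v : ell ι p →L[ℂ] ell ι p) (_ : IsMatrixOf coords coords v a), ‖v‖ₑ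

/-- The matrix `(|a_ij|)`. -/
def absMatrix (a : Matrix ι ι ℂ) : Matrix ι ι ℂ := a.map fun z => (‖z‖ : ℂ)

end Operators

end RegInterp

end

open scoped ENNReal NNReal ZeroAtInfty

noncomputable section

/-! Every norm in the theorem equals `schurENorm`, the best constant $C$ in $\sum
|a_{ij}|\,\xi_j^\theta\eta_i^{1-\theta}\le C(\sum\xi_j)^\theta(\sum\eta_i)^{1-\theta}$ over finite
nonnegative families. By Hölder duality this is the norm of $(|a_{ij}|)$ on $\ell_p$, $p=1/\theta$.
It is also the regular norm of $u$: on the one hand $\sup_k|u(x_k)|\le |a|\sup_k|x_k|$ pointwise; on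
the other, testing on the vectors $(\varepsilon_{ij}x_j)_j$, with $\varepsilon_{ij}$ the phases that
make row $i$ positive, recovers $(|a|x)_i$ at coordinate $i$.

The interpolation norms are caught in a cycle of inequalities. The first link,
`productENorm_le_schurENorm`, is the converse of the Schur test: for $\lambda>C$ there are positive
weights with $\sum_j|a_{ij}|x_j^\theta\le\lambda y_i^\theta$ and
$\sum_i|a_{ij}|y_i^{1-\theta}\le\lambda x_j^{1-\theta}$ (`IsSchurBound.exists_weights`, by monotone
iteration), and they split $|a|$ as $b^{1-\theta}c^\theta$ with the rows of $b$ and the columns of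
$c$ bounded by $\lambda$. Next, a factorization gives an analytic family $k_{ij}e^{z\ell_{ij}}$ with
value $a$ at $\theta$. Its primitive is admissible for the second method
(`upperENorm_le_productENorm`); for finite matrices, the family times a Gaussian factor is
admissible for the first (`lowerENorm_le_productENorm`). Finally, the three lines theorem applied to
$\sum\varepsilon_{ij}h_{ij}(z)\xi_j^z\eta_i^{1-z}$ bounds `schurENorm` by either interpolation norm
(`isSchurBound_of_strip`). -/

namespace RegInterp

/-! ## Schur bounds for nonnegative matrices -/

section Schur

open Filter Topology

variable {ι κ : Type*} {θ : ℝ} {A : ι → κ → ℝ≥0} {C : ℝ≥0}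

/-- The bilinear form of the nonnegative matrix `A` on `ℓ_p × ℓ_{p'}`, `p = 1/θ`, is bounded by
`C`; the elements of the unit balls are written as powers of elements of `ℓ_1`. -/
def IsSchurBound (θ : ℝ) (A : ι → κ → ℝ≥0) (C : ℝ≥0) : Prop :=
  ∀ (I : Finset ι) (J : Finset κ) (η : ι → ℝ≥0) (ξ : κ → ℝ≥0),
    ∑ i ∈ I, ∑ j ∈ J, A i j * ξ j ^ θ * η i ^ (1 - θ) ≤
      C * (∑ j ∈ J, ξ j) ^ θ * (∑ i ∈ I, η i) ^ (1 - θ)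

theorem IsSchurBound.transpose (h : IsSchurBound θ A C) :
    IsSchurBound (1 - θ) (fun j i => A i j) C := by
  intro J I ξ η
  rw [Finset.sum_comm]
  have := h I J η ξ
  rw [sub_sub_cancel]
  calc _ = ∑ i ∈ I, ∑ j ∈ J, A i j * ξ j ^ θ * η i ^ (1 - θ) :=
        Finset.sum_congr rfl fun i _ => Finset.sum_congr rfl fun j _ => by ring
    _ ≤ _ := this
    _ = _ := by ring

/-- Duality: with $t=Ax$, the choice $\eta_i=t_i^{1/\theta}$ is extremal in Hölder's inequality. It
turns the bilinear bound into $S\le C(\sum x_j^{1/\theta})^\theta S^{1-\theta}$ for $S=\sum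
t_i^{1/\theta}$, and $S^{1-\theta}$ cancels. -/
theorem IsSchurBound.sum_rpow_le (h : IsSchurBound θ A C) (h₀ : 0 < θ)
    (I : Finset ι) (J : Finset κ) (x : κ → ℝ≥0) :
    ∑ i ∈ I, (∑ j ∈ J, A i j * x j) ^ θ⁻¹ ≤ C ^ θ⁻¹ * ∑ j ∈ J, x j ^ θ⁻¹ := by
  set t : ι → ℝ≥0 := fun i => ∑ j ∈ J, A i j * x j with ht
  set S := ∑ i ∈ I, t i ^ θ⁻¹ with hS
  have hθ := h₀.ne'
  have key := h I J (fun i => t i ^ θ⁻¹) (fun j => x j ^ θ⁻¹)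
  have e1 : ∑ i ∈ I, ∑ j ∈ J, A i j * (x j ^ θ⁻¹) ^ θ * (t i ^ θ⁻¹) ^ (1 - θ) = S := by
    refine Finset.sum_congr rfl fun i _ => ?_
    rw [← Finset.sum_mul]
    have : ∀ j, (x j ^ θ⁻¹) ^ θ = x j := fun j => NNReal.rpow_inv_rpow hθ _
    simp only [this]
    change t i * _ = _
    rcases eq_or_ne (t i) 0 with h0 | h0
    · rw [h0, zero_mul, NNReal.zero_rpow (inv_ne_zero hθ)]
    · nth_rewrite 1 [← NNReal.rpow_one (t i)]
      rw [← NNReal.rpow_mul, ← NNReal.rpow_add h0]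
      congr 1
      field_simp
      ring
  rw [e1] at key
  rcases eq_or_ne S 0 with h0 | h0
  · rw [h0]; exact zero_le
  · have hpos : 0 < S ^ (1 - θ) := NNReal.rpow_pos (pos_iff_ne_zero.2 h0)
    have hsplit : S = S ^ θ * S ^ (1 - θ) := by
      rw [← NNReal.rpow_add h0]; simp
    have key2 : S ^ θ ≤ C * (∑ j ∈ J, x j ^ θ⁻¹) ^ θ := by
      refine le_of_mul_le_mul_right ?_ hpos
      rw [← hsplit]; exact key
    calc S = (S ^ θ) ^ θ⁻¹ := (NNReal.rpow_rpow_inv hθ _).symm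
      _ ≤ (C * (∑ j ∈ J, x j ^ θ⁻¹) ^ θ) ^ θ⁻¹ :=
        NNReal.rpow_le_rpow key2 (inv_nonneg.2 h₀.le)
      _ = _ := by rw [NNReal.mul_rpow, NNReal.rpow_rpow_inv hθ]

theorem IsSchurBound.tsum_rpow_le (h : IsSchurBound θ A C) (h₀ : 0 < θ)
    (x : κ → ℝ≥0∞) (hx : ∑' j, x j ^ θ⁻¹ ≠ ∞) :
    ∑' i, (∑' j, (A i j : ℝ≥0∞) * x j) ^ θ⁻¹ ≤ (C : ℝ≥0∞) ^ θ⁻¹ * ∑' j, x j ^ θ⁻¹ := by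
  have hinv : 0 < θ⁻¹ := inv_pos.2 h₀
  have hfin : ∀ j, x j ≠ ∞ := fun j hj => ENNReal.ne_top_of_tsum_ne_top hx j (by
    simp [hj, hinv])
  lift x to κ → ℝ≥0 using hfin
  refine ENNReal.summable.tsum_le_of_sum_le fun I => ?_
  have hlim : Tendsto (fun J : Finset κ => ∑ i ∈ I, (∑ j ∈ J, (A i j : ℝ≥0∞) * x j) ^ θ⁻¹) atTop
      (𝓝 (∑ i ∈ I, (∑' j, (A i j : ℝ≥0∞) * x j) ^ θ⁻¹)) :=
    tendsto_finsetSum _ fun i _ => (ENNReal.continuous_rpow_const.tendsto _).comp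
      (ENNReal.summable.hasSum)
  refine le_of_tendsto' hlim fun J => ?_
  have := h.sum_rpow_le h₀ I J x
  calc ∑ i ∈ I, (∑ j ∈ J, (A i j : ℝ≥0∞) * x j) ^ θ⁻¹
      = ((∑ i ∈ I, (∑ j ∈ J, A i j * x j) ^ θ⁻¹ : ℝ≥0) : ℝ≥0∞) := by
        push_cast
        refine Finset.sum_congr rfl fun i _ => ?_
        rw [ENNReal.coe_rpow_of_nonneg _ hinv.le]; push_cast; rfl
    _ ≤ ((C ^ θ⁻¹ * ∑ j ∈ J, x j ^ θ⁻¹ : ℝ≥0) : ℝ≥0∞) := by exact_mod_cast this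
    _ = (C : ℝ≥0∞) ^ θ⁻¹ * ∑ j ∈ J, (x j : ℝ≥0∞) ^ θ⁻¹ := by
        push_cast
        simp only [ENNReal.coe_rpow_of_nonneg _ hinv.le]
    _ ≤ _ := by gcongr; exact ENNReal.sum_le_tsum _

/-- The other half of the duality: apply the hypothesis to $\xi^\theta$ supported on `J`, then
Hölder's inequality with exponents $1/\theta$ and $1/(1-\theta)$. -/
theorem isSchurBound_of_rpow_le (h₀ : 0 < θ) (h₁ : θ < 1)
    (h : ∀ x : κ → ℝ≥0∞, ∑' j, x j ^ θ⁻¹ ≠ ∞ → ∀ I : Finset ι,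
      ∑ i ∈ I, (∑' j, (A i j : ℝ≥0∞) * x j) ^ θ⁻¹ ≤ (C : ℝ≥0∞) ^ θ⁻¹ * ∑' j, x j ^ θ⁻¹) :
    IsSchurBound θ A C := by
  classical
  intro I J η ξ
  have hinv : 0 < θ⁻¹ := inv_pos.2 h₀
  have hH : (θ⁻¹).HolderConjugate (1 - θ)⁻¹ := by
    rw [Real.holderConjugate_iff]
    exact ⟨(one_lt_inv₀ h₀).2 h₁, by simp⟩
  set x : κ → ℝ≥0∞ := fun j => if j ∈ J then ((ξ j ^ θ : ℝ≥0) : ℝ≥0∞) else 0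
  have hx : ∑' j, x j ^ θ⁻¹ = ((∑ j ∈ J, ξ j : ℝ≥0) : ℝ≥0∞) := by
    rw [tsum_eq_sum (s := J)]
    · push_cast
      refine Finset.sum_congr rfl fun j hj => ?_
      simp only [x, hj, if_true]
      rw [← ENNReal.coe_rpow_of_nonneg _ hinv.le, NNReal.rpow_rpow_inv h₀.ne']
    · intro j hj
      simp [x, hj, hinv]
  have hAx : ∀ i, ∑' j, (A i j : ℝ≥0∞) * x j = ((∑ j ∈ J, A i j * ξ j ^ θ : ℝ≥0) : ℝ≥0∞) := by
    intro i
    rw [tsum_eq_sum (s := J)]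
    · push_cast
      refine Finset.sum_congr rfl fun j hj => ?_
      simp only [x, hj, if_true]
    · intro j hj
      simp [x, hj]
  have key := h x (by rw [hx]; exact ENNReal.coe_ne_top) I
  simp only [hx, hAx, ← ENNReal.coe_rpow_of_nonneg _ hinv.le] at key
  have key' : ∑ i ∈ I, (∑ j ∈ J, A i j * ξ j ^ θ) ^ θ⁻¹ ≤ C ^ θ⁻¹ * ∑ j ∈ J, ξ j := by
    exact_mod_cast key
  calc ∑ i ∈ I, ∑ j ∈ J, A i j * ξ j ^ θ * η i ^ (1 - θ)
      = ∑ i ∈ I, (∑ j ∈ J, A i j * ξ j ^ θ) * η i ^ (1 - θ) := by simp only [Finset.sum_mul]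
    _ ≤ (∑ i ∈ I, (∑ j ∈ J, A i j * ξ j ^ θ) ^ θ⁻¹) ^ (1 / θ⁻¹) *
        (∑ i ∈ I, (η i ^ (1 - θ)) ^ (1 - θ)⁻¹) ^ (1 / (1 - θ)⁻¹) :=
      NNReal.inner_le_Lp_mul_Lq I _ _ hH
    _ ≤ (C ^ θ⁻¹ * ∑ j ∈ J, ξ j) ^ θ * (∑ i ∈ I, η i) ^ (1 - θ) := by
      simp only [one_div, inv_inv, NNReal.rpow_rpow_inv (sub_pos.2 h₁).ne']
      gcongr
    _ = _ := by rw [NNReal.mul_rpow, NNReal.rpow_inv_rpow h₀.ne']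

/-- The true factor is $(C/\lambda)^{1/\theta}$; since $1/\theta>1$ it is at most $C/\lambda<1$.
This cruder factor serves for $\theta$ and for $1-\theta$ alike, so both halves of `weightStep`
contract mass at the same rate. -/
theorem IsSchurBound.scaled_tsum_le (h : IsSchurBound θ A C) (h₀ : 0 < θ) (h₁ : θ < 1) {lam : ℝ≥0}
    (hlam : C < lam) {x : κ → ℝ≥0∞} {R : ℝ≥0} (hx : ∑' j, x j ≤ R) :
    ∑' i, ((lam : ℝ≥0∞)⁻¹ * ∑' j, (A i j : ℝ≥0∞) * x j ^ θ) ^ θ⁻¹ ≤ ((C / lam * R : ℝ≥0) : ℝ≥0∞) := by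
  have hinv : 0 < θ⁻¹ := inv_pos.2 h₀
  have hl0 : lam ≠ 0 := (lt_of_le_of_lt zero_le hlam).ne'
  have hpow : ∀ j, (x j ^ θ) ^ θ⁻¹ = x j := fun j => ENNReal.rpow_rpow_inv h₀.ne' _
  have h1 := h.tsum_rpow_le h₀ (fun j => x j ^ θ) (by
    simp only [hpow]; exact ne_top_of_le_ne_top ENNReal.coe_ne_top hx)
  simp only [hpow] at h1
  simp only [ENNReal.mul_rpow_of_nonneg _ _ hinv.le]
  rw [ENNReal.tsum_mul_left]
  have hr : (C / lam : ℝ≥0) ≤ 1 := div_le_one_of_le₀ hlam.le zero_le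
  calc (lam : ℝ≥0∞)⁻¹ ^ θ⁻¹ * ∑' i, (∑' j, (A i j : ℝ≥0∞) * x j ^ θ) ^ θ⁻¹
      ≤ (lam : ℝ≥0∞)⁻¹ ^ θ⁻¹ * ((C : ℝ≥0∞) ^ θ⁻¹ * R) := by
        gcongr; exact h1.trans (by gcongr)
    _ = (((C / lam) ^ θ⁻¹ * R : ℝ≥0) : ℝ≥0∞) := by
        rw [← mul_assoc, ← ENNReal.mul_rpow_of_nonneg _ _ hinv.le, ← ENNReal.coe_inv hl0,
          ← ENNReal.coe_mul, ← ENNReal.coe_rpow_of_nonneg _ hinv.le, ← ENNReal.coe_mul, mul_comm _ C,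
          div_eq_mul_inv]
    _ ≤ _ := by
        gcongr
        exact NNReal.rpow_le_self_of_le_one hr ((one_lt_inv₀ h₀).2 h₁).le

/-- One step of the fixed point iteration for the weights. -/
def weightStep (θ : ℝ) (A : ι → κ → ℝ≥0) (lam : ℝ≥0) (u : κ → ℝ≥0∞) (v : ι → ℝ≥0∞)
    (z : (κ → ℝ≥0∞) × (ι → ℝ≥0∞)) : (κ → ℝ≥0∞) × (ι → ℝ≥0∞) :=
  (fun j => u j + ((lam : ℝ≥0∞)⁻¹ * ∑' i, (A i j : ℝ≥0∞) * z.2 i ^ (1 - θ)) ^ (1 - θ)⁻¹,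
    fun i => v i + ((lam : ℝ≥0∞)⁻¹ * ∑' j, (A i j : ℝ≥0∞) * z.1 j ^ θ) ^ θ⁻¹)

theorem monotone_weightStep (h₀ : 0 < θ) (h₁ : θ < 1) (lam : ℝ≥0) (u : κ → ℝ≥0∞) (v : ι → ℝ≥0∞) :
    Monotone (weightStep θ A lam u v) := by
  have h₂ : 0 < 1 - θ := sub_pos.2 h₁
  rintro ⟨x, y⟩ ⟨x', y'⟩ ⟨hx, hy⟩
  refine ⟨fun j => ?_, fun i => ?_⟩
  · have : ∀ i, y i ≤ y' i := hy
    dsimp only [weightStep]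
    gcongr
    exact this _
  · have : ∀ i, x i ≤ x' i := hx
    dsimp only [weightStep]
    gcongr
    exact this _

theorem tsum_iSup_le {x : ℕ → κ → ℝ≥0∞} (hx : Monotone x) {R : ℝ≥0∞} (h : ∀ k, ∑' j, x k j ≤ R) :
    ∑' j, ⨆ k, x k j ≤ R := by
  refine ENNReal.summable.tsum_le_of_sum_le fun J => ?_
  refine le_of_tendsto' (tendsto_finsetSum J fun j _ =>
    tendsto_atTop_iSup fun k l hkl => hx hkl j) fun k => (ENNReal.sum_le_tsum J).trans (h k)

/-- Passage to the limit in the iteration. The weights need only satisfy inequalities, so it is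
enough that stage `k` of one sequence is controlled by stage `k + 1` of the other. -/
theorem tsum_mul_iSup_rpow_le {B : κ → ℝ≥0} (h₀ : 0 < θ) {lam : ℝ≥0} (hl0 : lam ≠ 0)
    {x : ℕ → κ → ℝ≥0∞} (hx : Monotone x) {y : ℕ → ℝ≥0∞}
    (h : ∀ k, ((lam : ℝ≥0∞)⁻¹ * ∑' j, (B j : ℝ≥0∞) * x k j ^ θ) ^ θ⁻¹ ≤ y (k + 1)) :
    ∑' j, (B j : ℝ≥0∞) * (⨆ k, x k j) ^ θ ≤ lam * (⨆ k, y k) ^ θ := by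
  refine ENNReal.summable.tsum_le_of_sum_le fun J => ?_
  have hlim : Tendsto (fun k => ∑ j ∈ J, (B j : ℝ≥0∞) * x k j ^ θ) atTop
      (𝓝 (∑ j ∈ J, (B j : ℝ≥0∞) * (⨆ k, x k j) ^ θ)) := by
    refine tendsto_finsetSum J fun j _ => ENNReal.Tendsto.const_mul ?_ (Or.inr ENNReal.coe_ne_top)
    exact (ENNReal.continuous_rpow_const.tendsto _).comp
      (tendsto_atTop_iSup fun k l hkl => hx hkl j)
  refine le_of_tendsto' hlim fun k => ?_
  have h1 : ((lam : ℝ≥0∞)⁻¹ * ∑' j, (B j : ℝ≥0∞) * x k j ^ θ) ≤ (⨆ k, y k) ^ θ := by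
    have := ENNReal.rpow_le_rpow ((h k).trans (le_iSup y (k + 1))) h₀.le
    rwa [ENNReal.rpow_inv_rpow h₀.ne'] at this
  calc ∑ j ∈ J, (B j : ℝ≥0∞) * x k j ^ θ ≤ ∑' j, (B j : ℝ≥0∞) * x k j ^ θ := ENNReal.sum_le_tsum J
    _ = lam * ((lam : ℝ≥0∞)⁻¹ * ∑' j, (B j : ℝ≥0∞) * x k j ^ θ) := by
        rw [← mul_assoc, ENNReal.mul_inv_cancel (by exact_mod_cast hl0) ENNReal.coe_ne_top, one_mul]
    _ ≤ _ := by gcongr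

/-- The converse of the Schur test. -/
theorem IsSchurBound.exists_weights [Countable ι] [Countable κ] (h : IsSchurBound θ A C)
    (h₀ : 0 < θ) (h₁ : θ < 1) {lam : ℝ≥0} (hlam : C < lam) :
    ∃ (x : κ → ℝ≥0) (y : ι → ℝ≥0), (∀ j, 0 < x j) ∧ (∀ i, 0 < y i) ∧
      (∀ i, ∑' j, (A i j : ℝ≥0∞) * (x j : ℝ≥0∞) ^ θ ≤ lam * (y i : ℝ≥0∞) ^ θ) ∧
      ∀ j, ∑' i, (A i j : ℝ≥0∞) * (y i : ℝ≥0∞) ^ (1 - θ) ≤ lam * (x j : ℝ≥0∞) ^ (1 - θ) := by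
  have h₂ : 0 < 1 - θ := sub_pos.2 h₁
  have hl0 : lam ≠ 0 := (lt_of_le_of_lt zero_le hlam).ne'
  have hr1 : C / lam < 1 := (div_lt_one (pos_iff_ne_zero.2 hl0)).2 hlam
  have hR0 : 1 - C / lam ≠ 0 := (tsub_pos_of_lt hr1).ne'
  -- The solution of $R=1+(C/\lambda)R$: total mass at most `R` is preserved by one step of the
  -- iteration, the $1$ being room for the sources `u` and `v`.
  obtain ⟨R, hR⟩ : ∃ R : ℝ≥0, 1 + C / lam * R ≤ R := by
    refine ⟨(1 - C / lam)⁻¹, le_of_eq ?_⟩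
    have : (1 - C / lam) * (1 - C / lam)⁻¹ + C / lam * (1 - C / lam)⁻¹ = (1 - C / lam)⁻¹ := by
      rw [← add_mul, tsub_add_cancel_of_le hr1.le, one_mul]
    rwa [mul_inv_cancel₀ hR0] at this
  -- Strictly positive sources of total mass below $1$, available because the index sets are
  -- countable; they force the limiting weights to be positive.
  obtain ⟨u, hu0, hu⟩ := ENNReal.exists_pos_sum_of_countable' one_ne_zero κ
  obtain ⟨v, hv0, hv⟩ := ENNReal.exists_pos_sum_of_countable' one_ne_zero ι
  set T := weightStep θ A lam u v with hT
  have hmono : Monotone fun k => T^[k] ⊥ :=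
    (monotone_weightStep h₀ h₁ lam u v).monotone_iterate_of_le_map bot_le
  have hstep : ∀ k, T^[k + 1] ⊥ = T (T^[k] ⊥) := fun k => Function.iterate_succ_apply' T k ⊥
  have hbound : ∀ k, ∑' j, (T^[k] ⊥).1 j ≤ R ∧ ∑' i, (T^[k] ⊥).2 i ≤ R := by
    intro k
    induction k with
    | zero => simp
    | succ k ih =>
      have hR' : (1 : ℝ≥0∞) + ((C / lam * R : ℝ≥0) : ℝ≥0∞) ≤ R := by exact_mod_cast hR
      rw [hstep]
      constructor
      · simp only [hT, weightStep]
        rw [ENNReal.tsum_add]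
        exact (add_le_add hu.le
          (h.transpose.scaled_tsum_le h₂ (by linarith) hlam ih.2)).trans hR'
      · simp only [hT, weightStep]
        rw [ENNReal.tsum_add]
        exact (add_le_add hv.le (h.scaled_tsum_le h₀ h₁ hlam ih.1)).trans hR'
  set X : ℕ → κ → ℝ≥0∞ := fun k => (T^[k] ⊥).1
  set Y : ℕ → ι → ℝ≥0∞ := fun k => (T^[k] ⊥).2
  have hX : Monotone X := fun k l hkl => (hmono hkl).1
  have hY : Monotone Y := fun k l hkl => (hmono hkl).2
  have hXs := tsum_iSup_le hX fun k => (hbound k).1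
  have hYs := tsum_iSup_le hY fun k => (hbound k).2
  have hXfin : ∀ j, (⨆ k, X k j) ≠ ∞ :=
    ENNReal.ne_top_of_tsum_ne_top (ne_top_of_le_ne_top ENNReal.coe_ne_top hXs)
  have hYfin : ∀ i, (⨆ k, Y k i) ≠ ∞ :=
    ENNReal.ne_top_of_tsum_ne_top (ne_top_of_le_ne_top ENNReal.coe_ne_top hYs)
  have hXstep : ∀ k j, X (k + 1) j =
      u j + ((lam : ℝ≥0∞)⁻¹ * ∑' i, (A i j : ℝ≥0∞) * Y k i ^ (1 - θ)) ^ (1 - θ)⁻¹ :=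
    fun k j => by simp only [X, hstep]; rfl
  have hYstep : ∀ k i, Y (k + 1) i =
      v i + ((lam : ℝ≥0∞)⁻¹ * ∑' j, (A i j : ℝ≥0∞) * X k j ^ θ) ^ θ⁻¹ :=
    fun k i => by simp only [Y, hstep]; rfl
  refine ⟨fun j => (⨆ k, X k j).toNNReal, fun i => (⨆ k, Y k i).toNNReal, fun j => ?_, fun i => ?_,
    fun i => ?_, fun j => ?_⟩
  · refine ENNReal.toNNReal_pos (ne_of_gt ((hu0 j).trans_le ?_)) (hXfin j)
    exact le_trans (by rw [hXstep 0]; exact le_self_add) (le_iSup (fun k => X k j) 1)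
  · refine ENNReal.toNNReal_pos (ne_of_gt ((hv0 i).trans_le ?_)) (hYfin i)
    exact le_trans (by rw [hYstep 0]; exact le_self_add) (le_iSup (fun k => Y k i) 1)
  · simp only [ENNReal.coe_toNNReal (hXfin _), ENNReal.coe_toNNReal (hYfin _)]
    exact tsum_mul_iSup_rpow_le (y := fun k => Y k i) h₀ hl0 hX fun k => by
      rw [hYstep]; exact le_add_self
  · simp only [ENNReal.coe_toNNReal (hXfin _), ENNReal.coe_toNNReal (hYfin _)]
    exact tsum_mul_iSup_rpow_le (y := fun k => X k j) (B := fun i => A i j) h₂ hl0 hY fun k => by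
      rw [hXstep]; exact le_add_self

end Schur

/-! ## The Calderón product -/

section Product

variable {ι : Type*} {θ : ℝ}

/-- With the weights of the converse Schur test, put $b_{ij}=|a_{ij}|x_j^\theta y_i^{-\theta}$ and
$c_{ij}=|a_{ij}|y_i^{1-\theta}x_j^{-(1-\theta)}$. The weights cancel in $b^{1-\theta}c^\theta=|a|$,
and the two weight inequalities say that the row sums of $b$ and the column sums of $c$ are at most
$\lambda$. -/
theorem productENorm_le_of_isSchurBound [Countable ι] {a : Matrix ι ι ℂ} {C : ℝ≥0} (h₀ : 0 < θ)
    (h₁ : θ < 1) (h : IsSchurBound θ (fun i j => ‖a i j‖₊) C) : productENorm ι θ a ≤ C := by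
  have h₂ : 0 < 1 - θ := sub_pos.2 h₁
  refine le_of_forall_gt fun c hc => ?_
  obtain ⟨lam, hlam, hlc⟩ := ENNReal.lt_iff_exists_nnreal_btwn.1 hc
  refine lt_of_le_of_lt ?_ hlc
  have hlam : C < lam := by exact_mod_cast hlam
  obtain ⟨x, y, hx, hy, hxy, hyx⟩ := h.exists_weights h₀ h₁ hlam
  set b : Matrix ι ι ℂ := fun i j => ((‖a i j‖₊ * x j ^ θ * (y i ^ θ)⁻¹ : ℝ≥0) : ℂ) with hb
  set c : Matrix ι ι ℂ := fun i j =>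
    ((‖a i j‖₊ * y i ^ (1 - θ) * (x j ^ (1 - θ))⁻¹ : ℝ≥0) : ℂ) with hc
  have hbrow : rowENorm b ≤ lam := by
    refine iSup_le fun i => ?_
    have hyi : y i ^ θ ≠ 0 := (NNReal.rpow_pos (hy i)).ne'
    calc ∑' j, ‖b i j‖ₑ = ∑' j, ‖a i j‖₊ * (x j : ℝ≥0∞) ^ θ * ((y i : ℝ≥0∞) ^ θ)⁻¹ := by
          refine tsum_congr fun j => ?_
          simp only [hb, enorm_eq_nnnorm, Complex.nnnorm_real, Real.nnnorm_of_nonneg NNReal.zero_le_coe]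
          rw [← ENNReal.coe_rpow_of_nonneg _ h₀.le, ← ENNReal.coe_rpow_of_nonneg _ h₀.le,
            ← ENNReal.coe_inv hyi]
          push_cast; rfl
      _ = (∑' j, ‖a i j‖₊ * (x j : ℝ≥0∞) ^ θ) * ((y i : ℝ≥0∞) ^ θ)⁻¹ := ENNReal.tsum_mul_right
      _ ≤ lam * (y i : ℝ≥0∞) ^ θ * ((y i : ℝ≥0∞) ^ θ)⁻¹ := by gcongr; exact hxy i
      _ = lam := by
          rw [mul_assoc, ENNReal.mul_inv_cancel, mul_one] <;>
          rw [← ENNReal.coe_rpow_of_nonneg _ h₀.le]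
          · exact_mod_cast hyi
          · exact ENNReal.coe_ne_top
  have hccol : colENorm c ≤ lam := by
    refine iSup_le fun j => ?_
    have hxj : x j ^ (1 - θ) ≠ 0 := (NNReal.rpow_pos (hx j)).ne'
    calc ∑' i, ‖c i j‖ₑ =
          ∑' i, ‖a i j‖₊ * (y i : ℝ≥0∞) ^ (1 - θ) * ((x j : ℝ≥0∞) ^ (1 - θ))⁻¹ := by
          refine tsum_congr fun i => ?_
          simp only [hc, enorm_eq_nnnorm, Complex.nnnorm_real, Real.nnnorm_of_nonneg NNReal.zero_le_coe]
          rw [← ENNReal.coe_rpow_of_nonneg _ h₂.le, ← ENNReal.coe_rpow_of_nonneg _ h₂.le,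
            ← ENNReal.coe_inv hxj]
          push_cast; rfl
      _ = (∑' i, ‖a i j‖₊ * (y i : ℝ≥0∞) ^ (1 - θ)) * ((x j : ℝ≥0∞) ^ (1 - θ))⁻¹ :=
          ENNReal.tsum_mul_right
      _ ≤ lam * (x j : ℝ≥0∞) ^ (1 - θ) * ((x j : ℝ≥0∞) ^ (1 - θ))⁻¹ := by gcongr; exact hyx j
      _ = lam := by
          rw [mul_assoc, ENNReal.mul_inv_cancel, mul_one] <;>
          rw [← ENNReal.coe_rpow_of_nonneg _ h₂.le]
          · exact_mod_cast hxj
          · exact ENNReal.coe_ne_top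
  obtain ⟨b₀, hb₀⟩ := (mem_rows b).2 (ne_top_of_le_ne_top ENNReal.coe_ne_top hbrow)
  obtain ⟨b₁, hb₁⟩ := (mem_cols c).2 (ne_top_of_le_ne_top ENNReal.coe_ne_top hccol)
  rw [← hb₀, ← enorm_rows] at hbrow
  rw [← hb₁, ← enorm_cols] at hccol
  have n₀ : ‖b₀‖ ≤ lam := by exact_mod_cast hbrow
  have n₁ : ‖b₁‖ ≤ lam := by exact_mod_cast hccol
  refine iInf_le_of_le b₀ (iInf_le_of_le b₁ (iInf_le_of_le (fun i j => le_of_eq ?_) ?_))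
  · rw [hb₀, hb₁]
    simp only [hb, hc]
    rw [← coe_nnnorm, ← coe_nnnorm, ← coe_nnnorm, ← NNReal.coe_rpow, ← NNReal.coe_rpow,
      ← NNReal.coe_mul, NNReal.coe_inj]
    simp only [Complex.nnnorm_real, Real.nnnorm_of_nonneg NNReal.zero_le_coe]
    change ‖a i j‖₊ = (‖a i j‖₊ * x j ^ θ * (y i ^ θ)⁻¹) ^ (1 - θ) *
      (‖a i j‖₊ * y i ^ (1 - θ) * (x j ^ (1 - θ))⁻¹) ^ θ
    rcases eq_or_ne ‖a i j‖₊ 0 with h0 | h0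
    · simp [h0, h₀.ne']
    · simp only [NNReal.mul_rpow, NNReal.inv_rpow, ← NNReal.rpow_mul]
      have e1 : ‖a i j‖₊ ^ (1 - θ) * ‖a i j‖₊ ^ θ = ‖a i j‖₊ := by
        rw [← NNReal.rpow_add h0]; simp
      have hX : x j ^ (θ * (1 - θ)) ≠ 0 := (NNReal.rpow_pos (hx j)).ne'
      have hY : y i ^ (θ * (1 - θ)) ≠ 0 := (NNReal.rpow_pos (hy i)).ne'
      rw [mul_comm (1 - θ) θ]
      nth_rewrite 1 [← e1]
      field_simp
  · rw [← ENNReal.ofReal_coe_nnreal]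
    refine ENNReal.ofReal_le_ofReal ?_
    calc ‖b₀‖ ^ (1 - θ) * ‖b₁‖ ^ θ ≤ (lam : ℝ) ^ (1 - θ) * (lam : ℝ) ^ θ := by gcongr
      _ = lam := by
        have : (lam : ℝ) ≠ 0 := by exact_mod_cast (lt_of_le_of_lt zero_le hlam).ne'
        rw [← Real.rpow_add (by positivity)]; simp

/-- An element of norm less than `M` of the Calderón product is the value at `θ` of an analytic
family of matrices `k_ij e^{z ℓ_ij}`, bounded by `M` on the two sides of the strip. -/
theorem exists_exponential_family {a : Matrix ι ι ℂ} {M : ℝ≥0} (h₀ : 0 < θ)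
    (h₁ : θ < 1) (h : productENorm ι θ a < M) :
    ∃ (k : Matrix ι ι ℂ) (l : Matrix ι ι ℝ), rowENorm k ≤ M ∧
      colENorm (fun i j => k i j * (Real.exp (l i j) : ℂ)) ≤ M ∧
      ∀ i j, k i j * Complex.exp (l i j * θ) = a i j := by
  have h₂ : 0 < 1 - θ := sub_pos.2 h₁
  simp only [productENorm, iInf_lt_iff] at h
  obtain ⟨b₀, b₁, hab, hM⟩ := h
  set m := ‖b₀‖ ^ (1 - θ) * ‖b₁‖ ^ θ with hm
  by_cases hz : ‖b₀‖ = 0 ∨ ‖b₁‖ = 0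
  · have ha : a = 0 := by
      ext i j
      have := hab i j
      rcases hz with hz | hz <;> rw [norm_eq_zero] at hz <;> subst hz
      · simpa [h₂.ne'] using this
      · simpa [h₀.ne'] using this
    refine ⟨0, 0, ?_, ?_, ?_⟩ <;> simp [ha, rowENorm, colENorm]
  push Not at hz
  have p₀ : 0 < ‖b₀‖ := lt_of_le_of_ne (norm_nonneg _) hz.1.symm
  have p₁ : 0 < ‖b₁‖ := lt_of_le_of_ne (norm_nonneg _) hz.2.symm
  have pm : 0 < m := by positivity
  -- The factors are rescaled so that both have norm $m$; as $m=\|b_0\|^{1-\theta}\|b_1\|^\theta$,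
  -- the product $\beta^{1-\theta}\gamma^\theta$ is unchanged.
  set β : ι → ι → ℝ := fun i j => m / ‖b₀‖ * ‖ofRows b₀ i j‖ with hβ
  set γ : ι → ι → ℝ := fun i j => m / ‖b₁‖ * ‖ofCols b₁ i j‖ with hγ
  have hab' : ∀ i j, ‖a i j‖ ≤ β i j ^ (1 - θ) * γ i j ^ θ := by
    intro i j
    refine (hab i j).trans (le_of_eq ?_)
    simp only [hβ, hγ]
    rw [Real.mul_rpow (by positivity) (by positivity), Real.mul_rpow (by positivity) (by positivity),
      Real.div_rpow pm.le p₀.le, Real.div_rpow pm.le p₁.le]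
    have e1 : m ^ (1 - θ) * m ^ θ = ‖b₀‖ ^ (1 - θ) * ‖b₁‖ ^ θ := by
      rw [← Real.rpow_add pm]; simp [hm]
    have q₀ : ‖b₀‖ ^ (1 - θ) ≠ 0 := by positivity
    have q₁ : ‖b₁‖ ^ θ ≠ 0 := by positivity
    have e2 : m ^ (1 - θ) / ‖b₀‖ ^ (1 - θ) * (m ^ θ / ‖b₁‖ ^ θ) = 1 := by
      field_simp; linear_combination e1
    linear_combination (-(‖ofRows b₀ i j‖ ^ (1 - θ) * ‖ofCols b₁ i j‖ ^ θ)) * e2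
  -- Then $|k_{ij}e^{z\ell_{ij}}|=|a_{ij}|(\gamma_{ij}/\beta_{ij})^{\mathrm{Re}\,z-\theta}$ where
  -- $a_{ij}\ne0$, which is at most $\beta_{ij}$ for $\mathrm{Re}\,z=0$ and at most $\gamma_{ij}$
  -- for $\mathrm{Re}\,z=1$. Where $a_{ij}=0$ also $k_{ij}=0$, and the value of the logarithm is
  -- immaterial.
  set l : Matrix ι ι ℝ := fun i j => Real.log (γ i j / β i j) with hl
  set k : Matrix ι ι ℂ := fun i j => a i j * Complex.exp (-(l i j * θ)) with hk
  have hnk : ∀ i j, ‖k i j‖ = ‖a i j‖ * Real.exp (-(l i j * θ)) := by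
    intro i j
    simp only [hk, norm_mul, Complex.norm_exp]
    simp
  have hpos : ∀ i j, a i j ≠ 0 → 0 < β i j ∧ 0 < γ i j := by
    intro i j hne
    have hpos := (norm_pos_iff.2 hne).trans_le (hab' i j)
    have b0 : 0 ≤ β i j := by positivity
    have g0 : 0 ≤ γ i j := by positivity
    constructor
    · refine lt_of_le_of_ne b0 fun h => ?_
      rw [← h, Real.zero_rpow h₂.ne', zero_mul] at hpos; exact lt_irrefl _ hpos
    · refine lt_of_le_of_ne g0 fun h => ?_
      rw [← h, Real.zero_rpow h₀.ne', mul_zero] at hpos; exact lt_irrefl _ hpos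
  have hkβ : ∀ i j, ‖k i j‖ ≤ β i j := by
    intro i j
    rw [hnk]
    rcases eq_or_ne (a i j) 0 with h0 | h0
    · rw [h0]; simp only [norm_zero, zero_mul]; positivity
    · obtain ⟨hb, hg⟩ := hpos i j h0
      have e : Real.exp (-(l i j * θ)) = γ i j ^ (-θ) * β i j ^ θ := by
        rw [Real.rpow_def_of_pos hg, Real.rpow_def_of_pos hb, ← Real.exp_add]
        simp only [hl]
        rw [Real.log_div hg.ne' hb.ne']
        ring_nf
      rw [e]
      calc ‖a i j‖ * (γ i j ^ (-θ) * β i j ^ θ)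
          ≤ β i j ^ (1 - θ) * γ i j ^ θ * (γ i j ^ (-θ) * β i j ^ θ) := by
            gcongr; exact hab' i j
        _ = (β i j ^ (1 - θ) * β i j ^ θ) * (γ i j ^ θ * γ i j ^ (-θ)) := by ring
        _ = β i j := by rw [← Real.rpow_add hb, ← Real.rpow_add hg]; simp
  have hkγ : ∀ i j, ‖k i j * (Real.exp (l i j) : ℂ)‖ ≤ γ i j := by
    intro i j
    rw [norm_mul, hnk, Complex.norm_real, Real.norm_of_nonneg (Real.exp_pos _).le]
    rcases eq_or_ne (a i j) 0 with h0 | h0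
    · rw [h0]; simp only [norm_zero, zero_mul]; positivity
    · obtain ⟨hb, hg⟩ := hpos i j h0
      have e : Real.exp (-(l i j * θ)) * Real.exp (l i j) = γ i j ^ (1 - θ) * β i j ^ (-(1 - θ)) := by
        rw [Real.rpow_def_of_pos hg, Real.rpow_def_of_pos hb, ← Real.exp_add, ← Real.exp_add]
        simp only [hl]
        rw [Real.log_div hg.ne' hb.ne']
        ring_nf
      rw [mul_assoc, e]
      calc ‖a i j‖ * (γ i j ^ (1 - θ) * β i j ^ (-(1 - θ)))
          ≤ β i j ^ (1 - θ) * γ i j ^ θ * (γ i j ^ (1 - θ) * β i j ^ (-(1 - θ))) := by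
            gcongr; exact hab' i j
        _ = (β i j ^ (1 - θ) * β i j ^ (-(1 - θ))) * (γ i j ^ θ * γ i j ^ (1 - θ)) := by ring
        _ = γ i j := by rw [← Real.rpow_add hb, ← Real.rpow_add hg]; simp
  have hmM : ENNReal.ofReal m ≤ M := hM.le
  have hscale : ∀ {r : ℝ}, 0 < r → ENNReal.ofReal (m / r) * ENNReal.ofReal r = ENNReal.ofReal m :=
    fun {r} hr => by rw [← ENNReal.ofReal_mul (by positivity), div_mul_cancel₀ _ hr.ne']
  refine ⟨k, l, ?_, ?_, ?_⟩
  · refine iSup_le fun i => ?_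
    calc ∑' j, ‖k i j‖ₑ ≤ ∑' j, ENNReal.ofReal (m / ‖b₀‖) * ‖ofRows b₀ i j‖ₑ := by
          refine ENNReal.tsum_le_tsum fun j => ?_
          rw [← ofReal_norm, ← ofReal_norm, ← ENNReal.ofReal_mul (by positivity)]
          exact ENNReal.ofReal_le_ofReal (hkβ i j)
      _ = ENNReal.ofReal (m / ‖b₀‖) * ∑' j, ‖ofRows b₀ i j‖ₑ := ENNReal.tsum_mul_left
      _ ≤ ENNReal.ofReal (m / ‖b₀‖) * ENNReal.ofReal ‖b₀‖ := by
          gcongr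
          rw [ofReal_norm, enorm_rows]
          exact le_iSup (fun i => ∑' j, ‖ofRows b₀ i j‖ₑ) i
      _ ≤ M := by rw [hscale p₀]; exact hmM
  · refine iSup_le fun j => ?_
    calc ∑' i, ‖k i j * (Real.exp (l i j) : ℂ)‖ₑ
        ≤ ∑' i, ENNReal.ofReal (m / ‖b₁‖) * ‖ofCols b₁ i j‖ₑ := by
          refine ENNReal.tsum_le_tsum fun i => ?_
          rw [← ofReal_norm, ← ofReal_norm, ← ENNReal.ofReal_mul (by positivity)]
          exact ENNReal.ofReal_le_ofReal (hkγ i j)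
      _ = ENNReal.ofReal (m / ‖b₁‖) * ∑' i, ‖ofCols b₁ i j‖ₑ := ENNReal.tsum_mul_left
      _ ≤ ENNReal.ofReal (m / ‖b₁‖) * ENNReal.ofReal ‖b₁‖ := by
          gcongr
          rw [ofReal_norm, enorm_cols]
          exact le_iSup (fun j => ∑' i, ‖ofCols b₁ i j‖ₑ) j
      _ ≤ M := by rw [hscale p₁]; exact hmM
  · intro i j
    simp only [hk]
    rw [mul_assoc, ← Complex.exp_add]
    simp

end Product

/-! ## The three lines argument -/

section ThreeLines

open Filter Topology Set

variable {ι κ : Type*} {θ : ℝ}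

/-- Three lines theorem for $F(z)=\sum\varepsilon_{ij}h_{ij}(z)\xi_j^z\eta_i^{1-z}$, with constant
phases chosen so that $F(\theta)$ is the sum to be bounded. On $\mathrm{Re}\,z=0$, $|F|$ is at most
an $\eta$-average of row sums; on $\mathrm{Re}\,z=1$, a $\xi$-average of column sums. Linear growth
is allowed because the difference quotients of the second method need it. -/
theorem sum_norm_mul_rpow_le_of_strip (h₀ : 0 < θ) (h₁ : θ < 1) {h : ℂ → Matrix ι ι ℂ} {M : ℝ≥0}
    (hd : ∀ i j, DiffContOnCl ℂ (fun z => h z i j) (Complex.re ⁻¹' Ioo 0 1))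
    (hg : ∀ i j, ∃ K, ∀ z ∈ Complex.re ⁻¹' Ioo (0 : ℝ) 1, ‖h z i j‖ ≤ K * (1 + ‖z‖))
    (hl : ∀ t : ℝ, rowENorm (h (t * Complex.I)) ≤ M)
    (hr : ∀ t : ℝ, colENorm (h (1 + t * Complex.I)) ≤ M)
    {I J : Finset ι} {η ξ : ι → ℝ} (hη : ∀ i ∈ I, 0 < η i) (hξ : ∀ j ∈ J, 0 < ξ j)
    (hη1 : ∑ i ∈ I, η i ≤ 1) (hξ1 : ∑ j ∈ J, ξ j ≤ 1) :
    ∑ i ∈ I, ∑ j ∈ J, ‖h θ i j‖ * ξ j ^ θ * η i ^ (1 - θ) ≤ M := by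
  choose ε hε1 hε using fun i j => RCLike.exists_norm_eq_mul_self (h θ i j)
  set G : ι → ι → ℂ → ℂ := fun i j z =>
    Complex.exp (Real.log (ξ j) * z) * Complex.exp (Real.log (η i) * (1 - z)) with hG
  set F : ℂ → ℂ := fun z => ∑ i ∈ I, ∑ j ∈ J, ε i j * h z i j * G i j z with hF
  have hGd : ∀ i j, Differentiable ℂ (G i j) := fun i j => by simp only [hG]; fun_prop
  have hGn : ∀ i ∈ I, ∀ j ∈ J, ∀ z, ‖G i j z‖ = ξ j ^ z.re * η i ^ (1 - z.re) := by
    intro i hi j hj z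
    simp only [hG, norm_mul, Complex.norm_exp, Real.rpow_def_of_pos (hξ j hj),
      Real.rpow_def_of_pos (hη i hi)]
    simp
  have hFd : DiffContOnCl ℂ F (Complex.re ⁻¹' Ioo 0 1) := by
    refine ⟨DifferentiableOn.fun_sum fun i _ => DifferentiableOn.fun_sum fun j _ => ?_,
      continuousOn_finsetSum _ fun i _ => continuousOn_finsetSum _ fun j _ => ?_⟩
    · exact ((hd i j).differentiableOn.const_mul _).mul (hGd i j).differentiableOn
    · exact ((hd i j).continuousOn.const_mul _).mul (hGd i j).continuous.continuousOn
  -- On a strip of width $1$ the Phragmén–Lindelöf principle tolerates growth $\exp(B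
  -- e^{c|\mathrm{Im}\,z|})$ with $c<\pi$; linear growth fits with $B=c=1$.
  have hexp : ∀ z ∈ Complex.re ⁻¹' Ioo (0 : ℝ) 1,
      1 + ‖z‖ ≤ Real.exp (1 * Real.exp (1 * |z.im|)) := by
    rintro z ⟨hz0, hz1⟩
    rw [one_mul, one_mul]
    have e1 : 1 + |z.im| ≤ Real.exp |z.im| := by linarith [Real.add_one_le_exp |z.im|]
    have e2 := Real.add_one_le_exp (Real.exp |z.im|)
    have e3 := Complex.norm_le_abs_re_add_abs_im z
    rw [abs_of_pos hz0] at e3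
    linarith
  have hFg : F =O[comap (_root_.abs ∘ Complex.im) atTop ⊓ 𝓟 (Complex.re ⁻¹' Ioo 0 1)]
      fun z => Real.exp (1 * Real.exp (1 * |z.im|)) := by
    refine Asymptotics.IsBigO.mono ?_ inf_le_right
    refine Asymptotics.IsBigO.fun_sum fun i hi => Asymptotics.IsBigO.fun_sum fun j hj => ?_
    obtain ⟨K, hK⟩ := hg i j
    refine Asymptotics.IsBigO.of_bound K ?_
    rw [eventually_principal]
    intro z hz
    have hξ1' : ξ j ≤ 1 := (Finset.single_le_sum (fun j hj => (hξ j hj).le) hj).trans hξ1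
    have hη1' : η i ≤ 1 := (Finset.single_le_sum (fun i hi => (hη i hi).le) hi).trans hη1
    have hG1 : ‖G i j z‖ ≤ 1 := by
      rw [hGn i hi j hj]
      exact mul_le_one₀ (Real.rpow_le_one (hξ j hj).le hξ1' hz.1.le)
        (Real.rpow_nonneg (hη i hi).le _)
        (Real.rpow_le_one (hη i hi).le hη1' (by linarith [hz.2]))
    have hK0 : 0 ≤ K := by
      have h1 : 0 ≤ K * (1 + ‖z‖) := (norm_nonneg _).trans (hK z hz)
      exact nonneg_of_mul_nonneg_left h1 (by positivity)
    rw [norm_mul, norm_mul, hε1, one_mul, Real.norm_of_nonneg (Real.exp_pos _).le]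
    calc ‖h z i j‖ * ‖G i j z‖ ≤ ‖h z i j‖ := mul_le_of_le_one_right (norm_nonneg _) hG1
      _ ≤ K * (1 + ‖z‖) := hK z hz
      _ ≤ _ := by gcongr; exact hexp z hz
  have hFle : ∀ z, ‖F z‖ ≤ ∑ i ∈ I, ∑ j ∈ J, ‖h z i j‖ * ‖G i j z‖ := by
    intro z
    refine (norm_sum_le _ _).trans (Finset.sum_le_sum fun i _ => (norm_sum_le _ _).trans
      (Finset.sum_le_sum fun j _ => ?_))
    rw [norm_mul, norm_mul, hε1, one_mul]
  have hsum : ∀ (s : Finset ι) (f : ι → ℂ), ∑' j, ‖f j‖ₑ ≤ M → ∑ j ∈ s, ‖f j‖ ≤ M := by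
    intro s f hf
    have := (ENNReal.sum_le_tsum s).trans hf
    simp only [enorm_eq_nnnorm] at this
    have h2 : ∑ j ∈ s, ‖f j‖₊ ≤ M := by exact_mod_cast this
    have h3 := NNReal.coe_le_coe.2 h2
    rwa [NNReal.coe_sum] at h3
  have hleft : ∀ z : ℂ, z.re = 0 → ‖F z‖ ≤ M := by
    intro z hz
    have hz' : z = (z.im : ℂ) * Complex.I := by
      apply Complex.ext <;> simp [hz]
    have hrow : ∀ i, ∑ j ∈ J, ‖h z i j‖ ≤ M := fun i => hsum J _ (by
      have := hl z.im
      rw [← hz'] at this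
      exact (le_iSup (fun i => ∑' j, ‖h z i j‖ₑ) i).trans this)
    calc ‖F z‖ ≤ ∑ i ∈ I, ∑ j ∈ J, ‖h z i j‖ * ‖G i j z‖ := hFle z
      _ = ∑ i ∈ I, (∑ j ∈ J, ‖h z i j‖) * η i := by
          refine Finset.sum_congr rfl fun i hi => ?_
          rw [Finset.sum_mul]
          refine Finset.sum_congr rfl fun j hj => ?_
          rw [hGn i hi j hj, hz]; simp
      _ ≤ ∑ i ∈ I, M * η i := Finset.sum_le_sum fun i hi =>
          mul_le_mul_of_nonneg_right (hrow i) (hη i hi).le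
      _ = M * ∑ i ∈ I, η i := by rw [Finset.mul_sum]
      _ ≤ M := mul_le_of_le_one_right M.2 hη1
  have hright : ∀ z : ℂ, z.re = 1 → ‖F z‖ ≤ M := by
    intro z hz
    have hz' : z = 1 + (z.im : ℂ) * Complex.I := by
      apply Complex.ext <;> simp [hz]
    have hcol : ∀ j, ∑ i ∈ I, ‖h z i j‖ ≤ M := fun j => hsum I (fun i => h z i j) (by
      have := hr z.im
      rw [← hz'] at this
      exact (le_iSup (fun j => ∑' i, ‖h z i j‖ₑ) j).trans this)
    calc ‖F z‖ ≤ ∑ i ∈ I, ∑ j ∈ J, ‖h z i j‖ * ‖G i j z‖ := hFle z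
      _ = ∑ j ∈ J, (∑ i ∈ I, ‖h z i j‖) * ξ j := by
          rw [Finset.sum_comm]
          refine Finset.sum_congr rfl fun j hj => ?_
          rw [Finset.sum_mul]
          refine Finset.sum_congr rfl fun i hi => ?_
          rw [hGn i hi j hj, hz]; simp
      _ ≤ ∑ j ∈ J, M * ξ j := Finset.sum_le_sum fun j hj =>
          mul_le_mul_of_nonneg_right (hcol j) (hξ j hj).le
      _ = M * ∑ j ∈ J, ξ j := by rw [Finset.mul_sum]
      _ ≤ M := mul_le_of_le_one_right M.2 hξ1
  have hπ : (1 : ℝ) < Real.pi / (1 - 0) := by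
    rw [sub_zero, div_one]; linarith [Real.pi_gt_three]
  have key := PhragmenLindelof.vertical_strip hFd ⟨1, hπ, 1, hFg⟩ hleft hright
    (z := (θ : ℂ)) (by simpa using h₀.le) (by simpa using h₁.le)
  refine le_trans (le_of_eq ?_) key
  have hFθ : F θ = ((∑ i ∈ I, ∑ j ∈ J, ‖h θ i j‖ * ξ j ^ θ * η i ^ (1 - θ) : ℝ) : ℂ) := by
    simp only [hF]
    push_cast
    refine Finset.sum_congr rfl fun i hi => Finset.sum_congr rfl fun j hj => ?_
    rw [← hε i j]
    simp only [hG, Real.rpow_def_of_pos (hξ j hj), Real.rpow_def_of_pos (hη i hi)]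
    push_cast
    rw [mul_assoc]; rfl
  rw [hFθ, Complex.norm_real, Real.norm_of_nonneg]
  exact Finset.sum_nonneg fun i hi => Finset.sum_nonneg fun j hj =>
    mul_nonneg (mul_nonneg (norm_nonneg _) (Real.rpow_nonneg (hξ j hj).le _))
      (Real.rpow_nonneg (hη i hi).le _)

theorem isSchurBound_of_strip (h₀ : 0 < θ) (h₁ : θ < 1) {h : ℂ → Matrix ι ι ℂ} {M : ℝ≥0}
    (hd : ∀ i j, DiffContOnCl ℂ (fun z => h z i j) (Complex.re ⁻¹' Ioo 0 1))
    (hg : ∀ i j, ∃ K, ∀ z ∈ Complex.re ⁻¹' Ioo (0 : ℝ) 1, ‖h z i j‖ ≤ K * (1 + ‖z‖))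
    (hl : ∀ t : ℝ, rowENorm (h (t * Complex.I)) ≤ M)
    (hr : ∀ t : ℝ, colENorm (h (1 + t * Complex.I)) ≤ M) :
    IsSchurBound θ (fun i j => ‖h θ i j‖₊) M := by
  have h₂ : 0 < 1 - θ := sub_pos.2 h₁
  intro I J η ξ
  set X := ∑ j ∈ J, ξ j with hX
  set Y := ∑ i ∈ I, η i with hY
  rcases eq_or_ne X 0 with hX0 | hX0
  · have hz : ∀ j ∈ J, ξ j = 0 := Finset.sum_eq_zero_iff.1 hX0
    refine le_trans (le_of_eq ?_) zero_le
    refine Finset.sum_eq_zero fun i _ => Finset.sum_eq_zero fun j hj => ?_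
    rw [hz j hj, NNReal.zero_rpow h₀.ne']; simp
  rcases eq_or_ne Y 0 with hY0 | hY0
  · have hz : ∀ i ∈ I, η i = 0 := Finset.sum_eq_zero_iff.1 hY0
    refine le_trans (le_of_eq ?_) zero_le
    refine Finset.sum_eq_zero fun i hi => Finset.sum_eq_zero fun j _ => ?_
    rw [hz i hi, NNReal.zero_rpow h₂.ne']; simp
  -- The strip estimate takes logarithms of the weights, so zero weights are discarded; their terms
  -- vanish because $\theta$ and $1-\theta$ are nonzero. The rest is normalized to total mass $1$.
  set I' := I.filter fun i => η i ≠ 0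
  set J' := J.filter fun j => ξ j ≠ 0
  have hXJ : ∑ j ∈ J', ξ j = X := Finset.sum_filter_ne_zero J
  have hYI : ∑ i ∈ I', η i = Y := Finset.sum_filter_ne_zero I
  have key := sum_norm_mul_rpow_le_of_strip h₀ h₁ hd hg hl hr (I := I') (J := J')
    (η := fun i => (η i / Y : ℝ≥0)) (ξ := fun j => (ξ j / X : ℝ≥0))
    (fun i hi => NNReal.coe_pos.2
      (div_pos (pos_iff_ne_zero.2 (Finset.mem_filter.1 hi).2) (pos_iff_ne_zero.2 hY0)))
    (fun j hj => NNReal.coe_pos.2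
      (div_pos (pos_iff_ne_zero.2 (Finset.mem_filter.1 hj).2) (pos_iff_ne_zero.2 hX0)))
    (by rw [← NNReal.coe_sum, ← Finset.sum_div, hYI, div_self hY0]; simp)
    (by rw [← NNReal.coe_sum, ← Finset.sum_div, hXJ, div_self hX0]; simp)
  have key' : ∑ i ∈ I', ∑ j ∈ J', ‖h θ i j‖₊ * (ξ j / X) ^ θ * (η i / Y) ^ (1 - θ) ≤ M := by
    rw [← NNReal.coe_le_coe]
    push_cast
    exact_mod_cast key
  have e1 : ∑ i ∈ I, ∑ j ∈ J, ‖h θ i j‖₊ * ξ j ^ θ * η i ^ (1 - θ) =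
      ∑ i ∈ I', ∑ j ∈ J', ‖h θ i j‖₊ * ξ j ^ θ * η i ^ (1 - θ) := by
    symm
    rw [Finset.sum_filter_of_ne]
    · refine Finset.sum_congr rfl fun i _ => ?_
      rw [Finset.sum_filter_of_ne]
      intro j _ hne h0
      rw [h0, NNReal.zero_rpow h₀.ne'] at hne; simp at hne
    · intro i _ hne h0
      rw [h0, NNReal.zero_rpow h₂.ne'] at hne; simp at hne
  rw [e1]
  have hXθ : X ^ θ ≠ 0 := (NNReal.rpow_pos (pos_iff_ne_zero.2 hX0)).ne'
  have hYθ : Y ^ (1 - θ) ≠ 0 := (NNReal.rpow_pos (pos_iff_ne_zero.2 hY0)).ne'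
  calc ∑ i ∈ I', ∑ j ∈ J', ‖h θ i j‖₊ * ξ j ^ θ * η i ^ (1 - θ)
      = (∑ i ∈ I', ∑ j ∈ J', ‖h θ i j‖₊ * (ξ j / X) ^ θ * (η i / Y) ^ (1 - θ)) *
          (X ^ θ * Y ^ (1 - θ)) := by
        simp only [Finset.sum_mul]
        refine Finset.sum_congr rfl fun i _ => Finset.sum_congr rfl fun j _ => ?_
        rw [NNReal.div_rpow, NNReal.div_rpow]
        field_simp
    _ ≤ M * (X ^ θ * Y ^ (1 - θ)) := by gcongr
    _ = _ := by ring

/-- Each instance of a Schur bound involves finitely many entries, so entrywise convergence is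
enough. -/
theorem isSchurBound_of_tendsto {α : Type*} {l : Filter α} [l.NeBot] {A : α → ι → κ → ℝ≥0}
    {B : ι → κ → ℝ≥0} {C : ℝ≥0} (hA : ∀ i j, Tendsto (fun s => A s i j) l (𝓝 (B i j)))
    (h : ∀ᶠ s in l, IsSchurBound θ (A s) C) : IsSchurBound θ B C := by
  intro I J η ξ
  have hlim : Tendsto (fun s => ∑ i ∈ I, ∑ j ∈ J, A s i j * ξ j ^ θ * η i ^ (1 - θ)) l
      (𝓝 (∑ i ∈ I, ∑ j ∈ J, B i j * ξ j ^ θ * η i ^ (1 - θ))) :=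
    tendsto_finsetSum _ fun i _ => tendsto_finsetSum _ fun j _ =>
      ((hA i j).mul_const _).mul_const _
  exact le_of_tendsto hlim (h.mono fun s hs => hs I J η ξ)

end ThreeLines

/-! ## Lower bounds for the interpolation norms -/

section LowerBounds

open Filter Topology Set

namespace Couple

variable {X₀ X₁ V : Type*} [NormedAddCommGroup X₀] [NormedSpace ℂ X₀] [CompleteSpace X₀]
  [NormedAddCommGroup X₁] [NormedSpace ℂ X₁] [CompleteSpace X₁]
  [AddCommGroup V] [Module ℂ V] [TopologicalSpace V] [IsTopologicalAddGroup V] [T2Space V]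
  (c : Couple X₀ X₁ V)

theorem continuous_toV : Continuous c.toV :=
  continuous_quot_lift _ c.addMap.continuous

/-- The inclusion `X₀ + X₁ ⊆ V` as a continuous linear map. -/
def toVCLM : c.Sum →L[ℂ] V := ⟨c.toV, c.continuous_toV⟩

theorem closure_strip : closure (Complex.re ⁻¹' Ioo (0 : ℝ) 1) = strip := by
  rw [Complex.closure_preimage_re, closure_Ioo zero_ne_one]; rfl

theorem isOpen_openStrip : IsOpen openStrip :=
  isOpen_Ioo.preimage Complex.continuous_re

theorem openStrip_subset_strip : openStrip ⊆ strip := fun _ hz => ⟨hz.1.le, hz.2.le⟩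

end Couple

open Couple

variable {ι : Type*} {θ : ℝ}

/-- The entry `a_ij`, as a functional on `A₀ + A₁`. -/
def entryCLM (i j : ι) : (matrixCouple ι).Sum →L[ℂ] ℂ :=
  ((ContinuousLinearMap.proj j : (ι → ℂ) →L[ℂ] ℂ).comp
    (ContinuousLinearMap.proj i : (ι → ι → ℂ) →L[ℂ] (ι → ℂ))).comp (matrixCouple ι).toVCLM

theorem isSchurBound_of_isLowerRep (h₀ : 0 < θ) (h₁ : θ < 1) {f : ℂ → (matrixCouple ι).Sum}
    {f₀ f₁ : C₀(ℝ, Families ι)} (h : (matrixCouple ι).IsLowerRep f f₀ f₁) :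
    IsSchurBound θ (fun i j => ‖(matrixCouple ι).toV (f θ) i j‖₊) (max ‖f₀‖₊ ‖f₁‖₊) := by
  have happ : ∀ (f : C₀(ℝ, Families ι)) t, ‖f t‖ ≤ ‖f‖ := fun f t => by
    rw [← ZeroAtInftyContinuousMap.norm_toBCF_eq_norm]
    exact f.toBCF.norm_coe_le_norm t
  refine isSchurBound_of_strip (h := fun z => (matrixCouple ι).toV (f z)) h₀ h₁ (fun i j => ?_)
    (fun i j => ?_) (fun t => ?_) fun t => ?_
  · refine ⟨(entryCLM i j).differentiable.comp_differentiableOn h.differentiableOn, ?_⟩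
    rw [closure_strip]
    exact (entryCLM i j).continuous.comp_continuousOn h.continuousOn
  · obtain ⟨K, hK⟩ := h.bounded
    refine ⟨‖entryCLM i j‖ * K, fun z hz => ?_⟩
    have hz' := openStrip_subset_strip hz
    have h1 : ‖entryCLM i j (f z)‖ ≤ ‖entryCLM i j‖ * K :=
      (entryCLM i j).le_opNorm_of_le (hK z hz')
    exact h1.trans (le_mul_of_one_le_right ((norm_nonneg _).trans h1) (by linarith [norm_nonneg z]))
  · rw [h.left, toV_inl]
    change rowENorm (ofRows (f₀ t)) ≤ _
    rw [← enorm_rows, enorm_eq_nnnorm, ENNReal.coe_le_coe]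
    exact le_max_of_le_left (happ f₀ t)
  · rw [h.right, toV_inr]
    change colENorm (ofCols (f₁ t)) ≤ _
    rw [← enorm_cols, enorm_eq_nnnorm, ENNReal.coe_le_coe]
    exact le_max_of_le_right (happ f₁ t)

/-- For fixed $s\ne0$ the quotient $(g(z+is)-g(z))/s$ has boundary values in the balls of radius $M$
and grows at most linearly, so the strip estimate applies to it. As $s\to0$ it tends at $\theta$ to
$i\,g'(\theta)$, whose entries have the same moduli as those of $g'(\theta)$. -/
theorem isSchurBound_of_isUpperRep (h₀ : 0 < θ) (h₁ : θ < 1) {g : ℂ → (matrixCouple ι).Sum}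
    {M : ℝ≥0} (h : (matrixCouple ι).IsUpperRep g M) :
    IsSchurBound θ (fun i j => ‖(matrixCouple ι).toV (deriv g (θ : ℂ)) i j‖₊) M := by
  set q : ℝ → ℂ → Matrix ι ι ℂ := fun s z =>
    (s : ℂ)⁻¹ • (matrixCouple ι).toV (g (z + s * Complex.I) - g z) with hq
  have hqe : ∀ s z i j, q s z i j = (s : ℂ)⁻¹ * (entryCLM i j (g (z + s * Complex.I)) -
      entryCLM i j (g z)) := by
    intro s z i j
    rw [← map_sub]
    rfl
  have hderiv : HasDerivAt g (deriv g (θ : ℂ)) (θ : ℂ) :=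
    (h.differentiableOn.differentiableAt
      (isOpen_openStrip.mem_nhds ⟨by simpa using h₀, by simpa using h₁⟩)).hasDerivAt
  have hshift : ∀ (s : ℝ) (z : ℂ), (z + s * Complex.I).re = z.re := fun s z => by simp
  refine isSchurBound_of_tendsto (l := 𝓝[≠] (0 : ℝ)) (A := fun s i j => ‖q s θ i j‖₊)
    (fun i j => ?_) ?_
  · have hlin : HasDerivAt (fun s : ℝ => (θ : ℂ) + s * Complex.I) Complex.I 0 := by
      simpa using (Complex.ofRealCLM.hasDerivAt (x := (0 : ℝ))).mul_const Complex.I |>.const_add (θ : ℂ)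
    have h1 : HasDerivAt g (deriv g (θ : ℂ)) ((θ : ℂ) + (0 : ℝ) * Complex.I) := by
      simpa using hderiv
    have h2 := h1.scomp (0 : ℝ) hlin
    have h3 : HasDerivAt (fun s : ℝ => entryCLM i j (g (θ + s * Complex.I)))
        (entryCLM i j (Complex.I • deriv g (θ : ℂ))) 0 :=
      ((entryCLM i j).restrictScalars ℝ).hasFDerivAt.comp_hasDerivAt _ h2
    have h4 := h3.tendsto_slope_zero.nnnorm
    rw [map_smul, nnnorm_smul, Complex.nnnorm_I, one_mul] at h4
    refine h4.congr fun s => ?_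
    rw [hqe]
    simp only [zero_add, Complex.real_smul]
    simp
  · filter_upwards [self_mem_nhdsWithin] with s hs
    have hs : s ≠ 0 := hs
    refine isSchurBound_of_strip h₀ h₁ (fun i j => ?_) (fun i j => ?_) (fun t => ?_) fun t => ?_
    · simp only [hqe]
      have hent : DiffContOnCl ℂ (fun z => entryCLM i j (g z)) (Complex.re ⁻¹' Ioo 0 1) := by
        refine ⟨(entryCLM i j).differentiable.comp_differentiableOn h.differentiableOn, ?_⟩
        rw [closure_strip]
        exact (entryCLM i j).continuous.comp_continuousOn h.continuousOn
      have hent' : DiffContOnCl ℂ (fun z => entryCLM i j (g (z + s * Complex.I)))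
          (Complex.re ⁻¹' Ioo 0 1) := by
        refine hent.comp (g := fun z : ℂ => z + s * Complex.I)
          (differentiable_id.add_const _).diffContOnCl fun z hz => ?_
        change (z + s * Complex.I).re ∈ Ioo (0 : ℝ) 1
        rw [hshift]; exact hz
      exact (hent'.sub hent).const_smul ((s : ℂ)⁻¹)
    · obtain ⟨K, hK⟩ := h.growth
      refine ⟨|s|⁻¹ * ‖entryCLM i j‖ * (|K| * (2 + |s|)), fun z hz => ?_⟩
      have hz1 : z ∈ strip := openStrip_subset_strip hz
      have hz2 : z + s * Complex.I ∈ strip := by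
        refine openStrip_subset_strip ⟨?_, ?_⟩ <;> rw [hshift]
        exacts [hz.1, hz.2]
      have hn : ‖z + s * Complex.I‖ ≤ ‖z‖ + |s| := by
        refine (norm_add_le _ _).trans ?_
        simp
      have k1 : ‖g z‖ ≤ |K| * (1 + ‖z‖) := (hK z hz1).trans (by gcongr; exact le_abs_self K)
      have k2 : ‖g (z + s * Complex.I)‖ ≤ |K| * (1 + (‖z‖ + |s|)) :=
        (hK _ hz2).trans (by gcongr; exact le_abs_self K)
      rw [hqe, ← map_sub, norm_mul, norm_inv, Complex.norm_real, Real.norm_eq_abs]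
      have k3 : ‖g (z + s * Complex.I) - g z‖ ≤ |K| * (2 + |s|) * (1 + ‖z‖) := by
        refine (norm_sub_le _ _).trans ((add_le_add k2 k1).trans ?_)
        rw [← mul_add, mul_assoc]
        gcongr
        nlinarith [norm_nonneg z, abs_nonneg s]
      calc |s|⁻¹ * ‖entryCLM i j (g (z + s * Complex.I) - g z)‖
          ≤ |s|⁻¹ * (‖entryCLM i j‖ * (|K| * (2 + |s|) * (1 + ‖z‖))) := by
            gcongr; exact (entryCLM i j).le_opNorm_of_le k3
        _ = _ := by ring
    · obtain ⟨x, hx, hxM⟩ := h.left (t + s) t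
      have hqx : q s (t * Complex.I) = ofRows ((s : ℂ)⁻¹ • x) := by
        simp only [hq]
        rw [map_smul]
        congr 1
        have : (t : ℂ) * Complex.I + s * Complex.I = ((t + s : ℝ) : ℂ) * Complex.I := by
          push_cast; ring
        rw [this, ← hx, toV_inl]; rfl
      rw [hqx, ← enorm_rows, enorm_eq_nnnorm, ENNReal.coe_le_coe, ← NNReal.coe_le_coe, coe_nnnorm,
        norm_smul, norm_inv, Complex.norm_real, Real.norm_eq_abs]
      rw [add_sub_cancel_left] at hxM
      rw [inv_mul_le_iff₀ (abs_pos.2 hs), mul_comm]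
      exact hxM
    · obtain ⟨x, hx, hxM⟩ := h.right (t + s) t
      have hqx : q s (1 + t * Complex.I) = ofCols ((s : ℂ)⁻¹ • x) := by
        simp only [hq]
        rw [map_smul]
        congr 1
        have : 1 + (t : ℂ) * Complex.I + s * Complex.I = 1 + ((t + s : ℝ) : ℂ) * Complex.I := by
          push_cast; ring
        rw [this, ← hx, toV_inr]; rfl
      rw [hqx, ← enorm_cols, enorm_eq_nnnorm, ENNReal.coe_le_coe, ← NNReal.coe_le_coe, coe_nnnorm,
        norm_smul, norm_inv, Complex.norm_real, Real.norm_eq_abs]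
      rw [add_sub_cancel_left] at hxM
      rw [inv_mul_le_iff₀ (abs_pos.2 hs), mul_comm]
      exact hxM

end LowerBounds

/-! ## Upper bounds for the interpolation norms -/

/-! ### Primitives of exponentials, with estimates uniform in the exponent. -/

section ExpPrimitive

open Set Metric

/-- The primitive of `e^{lz}` that vanishes at `0`. -/
def expPrimitive (l : ℝ) (z : ℂ) : ℂ := if l = 0 then z else (Complex.exp (l * z) - 1) / l

theorem hasDerivAt_cexp_mul (l : ℝ) (z : ℂ) :
    HasDerivAt (fun z : ℂ => Complex.exp (l * z)) (l * Complex.exp (l * z)) z := by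
  have := ((hasDerivAt_id z).const_mul (l : ℂ)).cexp
  simpa [mul_comm] using this

theorem hasDerivAt_expPrimitive (l : ℝ) (z : ℂ) :
    HasDerivAt (expPrimitive l) (Complex.exp (l * z)) z := by
  by_cases hl : l = 0
  · subst hl
    have : expPrimitive 0 = id := by ext z; simp [expPrimitive]
    rw [this]
    simpa using hasDerivAt_id z
  · have hl' : (l : ℂ) ≠ 0 := by exact_mod_cast hl
    have h1 : expPrimitive l = fun z => (Complex.exp (l * z) - 1) / l := by
      ext z; simp [expPrimitive, hl]
    rw [h1]
    have h2 := ((hasDerivAt_cexp_mul l z).sub_const 1).div_const (l : ℂ)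
    rwa [mul_div_cancel_left₀ _ hl'] at h2

theorem expPrimitive_zero (l : ℝ) : expPrimitive l 0 = 0 := by simp [expPrimitive]

theorem norm_cexp_ofReal_mul (l : ℝ) (z : ℂ) : ‖Complex.exp (l * z)‖ = Real.exp (l * z.re) := by
  rw [Complex.norm_exp]; simp

theorem norm_expPrimitive_sub_le {s : Set ℂ} (hs : Convex ℝ s) {l B : ℝ}
    (h : ∀ z ∈ s, Real.exp (l * z.re) ≤ B) {z w : ℂ} (hz : z ∈ s) (hw : w ∈ s) :
    ‖expPrimitive l z - expPrimitive l w‖ ≤ B * ‖z - w‖ :=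
  hs.norm_image_sub_le_of_norm_hasDerivWithin_le
    (fun v _ => (hasDerivAt_expPrimitive l v).hasDerivWithinAt)
    (fun v hv => (norm_cexp_ofReal_mul l v).trans_le (h v hv)) hw hz

theorem exp_mul_le (l : ℝ) {x : ℝ} (hx₀ : 0 ≤ x) (hx₁ : x ≤ 1) :
    Real.exp (l * x) ≤ 1 + Real.exp l := by
  rcases le_total 0 l with hl | hl
  · have : Real.exp (l * x) ≤ Real.exp l := Real.exp_le_exp.2 (mul_le_of_le_one_right hl hx₁)
    linarith
  · have : Real.exp (l * x) ≤ 1 := Real.exp_le_one_iff.2 (mul_nonpos_of_nonpos_of_nonneg hl hx₀)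
    linarith [Real.exp_pos l]

/-- The factor $|l|$ is absorbed by $\delta|l|\le e^{\delta|l|}$, which moves $x$ by $\pm\delta$ and
leaves it in $[0,1]$. The bound relative to $1+e^l$ is uniform in $l$, as required when the
exponents $\ell_{ij}$ are unbounded. -/
theorem abs_mul_exp_mul_le (l : ℝ) {x δ : ℝ} (hδ : 0 < δ) (hx₀ : δ ≤ x) (hx₁ : x ≤ 1 - δ) :
    |l| * Real.exp (l * x) ≤ δ⁻¹ * (1 + Real.exp l) := by
  have h1 : δ * |l| ≤ Real.exp (δ * |l|) := by linarith [Real.add_one_le_exp (δ * |l|)]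
  have h2 : Real.exp (δ * |l|) * Real.exp (l * x) ≤ 1 + Real.exp l := by
    rw [← Real.exp_add]
    rcases le_total 0 l with hl | hl
    · rw [abs_of_nonneg hl]
      have : δ * l + l * x = l * (x + δ) := by ring
      rw [this]
      exact exp_mul_le l (by linarith) (by linarith)
    · rw [abs_of_nonpos hl]
      have : δ * -l + l * x = l * (x - δ) := by ring
      rw [this]
      exact exp_mul_le l (by linarith) (by linarith)
  rw [le_inv_mul_iff₀ hδ, ← mul_assoc]
  exact (mul_le_mul_of_nonneg_right h1 (Real.exp_pos _).le).trans h2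

/-- Mean value inequality twice: for $e^{lv}$ on the ball of radius $\delta$, where the margin
$2\delta$ leaves distance $\delta$ to the sides of the strip, then for the primitive minus its
linear part. -/
theorem norm_expPrimitive_sub_sub_le {z₀ : ℂ} {δ : ℝ} (hδ : 0 < δ)
    (hδ₀ : 2 * δ ≤ z₀.re) (hδ₁ : z₀.re ≤ 1 - 2 * δ) (l : ℝ) {w : ℂ} (hw : ‖w - z₀‖ < δ) :
    ‖expPrimitive l w - expPrimitive l z₀ - (w - z₀) * Complex.exp (l * z₀)‖ ≤
      δ⁻¹ * (1 + Real.exp l) * ‖w - z₀‖ * ‖w - z₀‖ := by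
  have hre : ∀ v ∈ ball z₀ δ, δ ≤ v.re ∧ v.re ≤ 1 - δ := by
    intro v hv
    have h1 : |(v - z₀).re| ≤ ‖v - z₀‖ := Complex.abs_re_le_norm _
    rw [mem_ball_iff_norm] at hv
    rw [Complex.sub_re, abs_le] at h1
    constructor <;> linarith [h1.1, h1.2]
  have hexp : ∀ v ∈ ball z₀ δ, ‖Complex.exp (l * v) - Complex.exp (l * z₀)‖ ≤
      δ⁻¹ * (1 + Real.exp l) * ‖v - z₀‖ := by
    intro v hv
    refine (convex_ball z₀ δ).norm_image_sub_le_of_norm_hasDerivWithin_le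
      (fun v _ => (hasDerivAt_cexp_mul l v).hasDerivWithinAt) (fun v hv => ?_)
      (mem_ball_self hδ) hv
    rw [norm_mul, norm_cexp_ofReal_mul, Complex.norm_real, Real.norm_eq_abs]
    exact abs_mul_exp_mul_le l hδ (hre v hv).1 (hre v hv).2
  have key := (convex_closedBall z₀ ‖w - z₀‖).norm_image_sub_le_of_norm_hasDerivWithin_le
    (f := fun v => expPrimitive l v - v * Complex.exp (l * z₀))
    (f' := fun v => Complex.exp (l * v) - 1 * Complex.exp (l * z₀))
    (C := δ⁻¹ * (1 + Real.exp l) * ‖w - z₀‖)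
    (fun v _ => ((hasDerivAt_expPrimitive l v).sub
      ((hasDerivAt_id v).mul_const _)).hasDerivWithinAt) (fun v hv => ?_)
    (mem_closedBall_self (norm_nonneg _)) (mem_closedBall_iff_norm.2 le_rfl)
  · refine le_trans (le_of_eq ?_) key
    congr 1; ring
  · rw [mem_closedBall_iff_norm] at hv
    rw [one_mul]
    refine (hexp v (mem_ball_iff_norm.2 (hv.trans_lt hw))).trans ?_
    have : 0 ≤ δ⁻¹ * (1 + Real.exp l) := by positivity
    gcongr

end ExpPrimitive

/-! ### The second method: primitives of exponential families of matrices. -/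

section UpperBounds

open Filter Topology Set

namespace Couple

variable {X₀ X₁ V : Type*} [NormedAddCommGroup X₀] [NormedSpace ℂ X₀] [CompleteSpace X₀]
  [NormedAddCommGroup X₁] [NormedSpace ℂ X₁] [CompleteSpace X₁]
  [AddCommGroup V] [Module ℂ V] [TopologicalSpace V] [IsTopologicalAddGroup V] [T2Space V]
  (c : Couple X₀ X₁ V)

theorem norm_inl_le (x : X₀) : ‖c.inl x‖ ≤ ‖x‖ := by
  refine (Submodule.Quotient.norm_mk_le _ _).trans (le_of_eq ?_)
  rw [WithLp.prod_norm_eq_of_L1]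
  simp

theorem norm_inr_le (x : X₁) : ‖c.inr x‖ ≤ ‖x‖ := by
  refine (Submodule.Quotient.norm_mk_le _ _).trans (le_of_eq ?_)
  rw [WithLp.prod_norm_eq_of_L1]
  simp

end Couple

open Couple

variable {ι : Type*} {θ : ℝ}

theorem norm_le_of_rows_le {k : Matrix ι ι ℂ} {M K : ℝ≥0} (hk : rowENorm k ≤ M) {h : Matrix ι ι ℂ}
    (hh : ∀ i j, ‖h i j‖ ≤ K * ‖k i j‖) : rowENorm h ≤ ((K * M : ℝ≥0) : ℝ≥0∞) := by
  refine iSup_le fun i => ?_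
  calc ∑' j, ‖h i j‖ₑ ≤ ∑' j, K * ‖k i j‖ₑ := ENNReal.tsum_le_tsum fun j => by
        simp only [enorm_eq_nnnorm]; exact_mod_cast hh i j
    _ = K * ∑' j, ‖k i j‖ₑ := ENNReal.tsum_mul_left
    _ ≤ K * M := by gcongr; exact (le_iSup (fun i => ∑' j, ‖k i j‖ₑ) i).trans hk
    _ = _ := by push_cast; rfl

theorem exists_ofRows {k : Matrix ι ι ℂ} {M K : ℝ≥0} (hk : rowENorm k ≤ M) {h : Matrix ι ι ℂ}
    (hh : ∀ i j, ‖h i j‖ ≤ K * ‖k i j‖) : ∃ x, ofRows x = h ∧ ‖x‖ ≤ K * M := by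
  have h1 := norm_le_of_rows_le hk hh
  obtain ⟨x, rfl⟩ := (mem_rows h).2 (ne_top_of_le_ne_top ENNReal.coe_ne_top h1)
  rw [← enorm_rows] at h1
  exact ⟨x, rfl, by exact_mod_cast h1⟩

theorem exists_ofCols {k : Matrix ι ι ℂ} {M K : ℝ≥0} (hk : colENorm k ≤ M) {h : Matrix ι ι ℂ}
    (hh : ∀ i j, ‖h i j‖ ≤ K * ‖k i j‖) : ∃ x, ofCols x = h ∧ ‖x‖ ≤ K * M := by
  obtain ⟨x, hx, hxM⟩ := exists_ofRows (k := k.transpose) (h := h.transpose) hk fun i j => hh j i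
  exact ⟨x, by rw [← h.transpose_transpose, ← hx]; rfl, hxM⟩

variable {k : Matrix ι ι ℂ} {l : Matrix ι ι ℝ} {M : ℝ≥0}

/-- Split $h=h\,(1+e^l)^{-1}+h\,e^l(1+e^l)^{-1}$: the first term is dominated by $K|k|$, hence
bounded in $A_0$, the second by $K|k|e^l$, hence bounded in $A_1$. Thus domination by $|k|(1+e^l)$
converts entrywise estimates into estimates in $A_0+A_1$. -/
theorem exists_sum_of_le (hk : rowENorm k ≤ M)
    (hkl : colENorm (fun i j => k i j * (Real.exp (l i j) : ℂ)) ≤ M) {h : Matrix ι ι ℂ} {K : ℝ≥0}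
    (hh : ∀ i j, ‖h i j‖ ≤ K * (‖k i j‖ * (1 + Real.exp (l i j)))) :
    ∃ s, (matrixCouple ι).toV s = h ∧ ‖s‖ ≤ 2 * M * K := by
  obtain ⟨x, hx, hxM⟩ := exists_ofRows (K := K) hk
    (h := fun i j => h i j * (((1 + Real.exp (l i j))⁻¹ : ℝ) : ℂ)) fun i j => by
      have hp : 0 < 1 + Real.exp (l i j) := by positivity
      rw [norm_mul, Complex.norm_real, Real.norm_of_nonneg (by positivity),
        mul_inv_le_iff₀ hp, mul_assoc]
      exact hh i j
  obtain ⟨y, hy, hyM⟩ := exists_ofCols (K := K) hkl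
    (h := fun i j => h i j * ((Real.exp (l i j) * (1 + Real.exp (l i j))⁻¹ : ℝ) : ℂ)) fun i j => by
      have hp : 0 < 1 + Real.exp (l i j) := by positivity
      rw [norm_mul, norm_mul, Complex.norm_real, Complex.norm_real,
        Real.norm_of_nonneg (by positivity), Real.norm_of_nonneg (by positivity), ← mul_assoc,
        mul_inv_le_iff₀ hp]
      calc ‖h i j‖ * Real.exp (l i j)
          ≤ K * (‖k i j‖ * (1 + Real.exp (l i j))) * Real.exp (l i j) := by gcongr; exact hh i j
        _ = _ := by ring
  refine ⟨(matrixCouple ι).inl x + (matrixCouple ι).inr y, ?_, ?_⟩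
  · rw [map_add, toV_inl, toV_inr]
    change ofRows x + ofCols y = h
    rw [hx, hy]
    ext i j
    have hp : (1 + Real.exp (l i j)) ≠ 0 := by positivity
    change h i j * _ + h i j * _ = h i j
    rw [← mul_add, ← Complex.ofReal_add]
    have : (1 + Real.exp (l i j))⁻¹ + Real.exp (l i j) * (1 + Real.exp (l i j))⁻¹ = 1 := by
      field_simp
    rw [this]; simp
  · refine (norm_add_le _ _).trans ?_
    have h1 := ((matrixCouple ι).norm_inl_le x).trans hxM
    have h2 := ((matrixCouple ι).norm_inr_le y).trans hyM
    linarith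

theorem norm_sum_le_of_le (hk : rowENorm k ≤ M)
    (hkl : colENorm (fun i j => k i j * (Real.exp (l i j) : ℂ)) ≤ M) {s : (matrixCouple ι).Sum}
    {K : ℝ≥0} (hs : ∀ i j, ‖(matrixCouple ι).toV s i j‖ ≤ K * (‖k i j‖ * (1 + Real.exp (l i j)))) :
    ‖s‖ ≤ 2 * M * K := by
  obtain ⟨s', h1, h2⟩ := exists_sum_of_le hk hkl hs
  rwa [(matrixCouple ι).toV_injective h1] at h2

theorem convex_re_eq (r : ℝ) : Convex ℝ {z : ℂ | z.re = r} :=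
  (convex_singleton r).linear_preimage Complex.reLm

/-- For infinite matrices $z\mapsto(k_{ij}e^{z\ell_{ij}})$ need not be norm continuous up to the
sides of the strip. Its entrywise primitive is Lipschitz on the closed strip, and in the interior
the uniform Taylor estimate makes it differentiable in the norm of $A_0+A_1$. -/
theorem exists_isUpperRep (hk : rowENorm k ≤ M)
    (hkl : colENorm (fun i j => k i j * (Real.exp (l i j) : ℂ)) ≤ M) :
    ∃ g, (matrixCouple ι).IsUpperRep g M ∧ ∀ z ∈ openStrip,
      (matrixCouple ι).toV (deriv g z) = fun i j => k i j * Complex.exp (l i j * z) := by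
  have hconv : Convex ℝ strip := by
    have : strip = Complex.reLm ⁻¹' Icc 0 1 := rfl
    rw [this]; exact (convex_Icc 0 1).linear_preimage Complex.reLm
  set H : ℂ → Matrix ι ι ℂ := fun z i j => k i j * expPrimitive (l i j) z with hH
  have hHsub : ∀ z w i j, H z i j - H w i j =
      k i j * (expPrimitive (l i j) z - expPrimitive (l i j) w) := fun z w i j => by
    simp only [hH]; ring
  have hlip : ∀ z ∈ strip, ∀ w ∈ strip, ∀ i j,
      ‖H z i j - H w i j‖ ≤ ‖z - w‖₊ * (‖k i j‖ * (1 + Real.exp (l i j))) := by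
    intro z hz w hw i j
    rw [hHsub, norm_mul, coe_nnnorm]
    have := norm_expPrimitive_sub_le hconv (l := l i j) (fun v hv => exp_mul_le (l i j) hv.1 hv.2)
      hz hw
    calc _ ≤ ‖k i j‖ * ((1 + Real.exp (l i j)) * ‖z - w‖) := by gcongr
      _ = _ := by ring
  have h0s : (0 : ℂ) ∈ strip := ⟨by simp, by simp⟩
  have hex : ∀ z ∈ strip, ∃ s, (matrixCouple ι).toV s = H z := fun z hz => by
    obtain ⟨s, hs, -⟩ := exists_sum_of_le hk hkl (h := H z) (K := ‖z - 0‖₊) fun i j => by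
      have := hlip z hz 0 h0s i j
      have h0 : H 0 i j = 0 := by simp [hH, expPrimitive_zero]
      rwa [h0, sub_zero] at this
    exact ⟨s, hs⟩
  -- The lift of $H$ to $A_0+A_1$. Where no lift exists `invFun` gives an arbitrary value, but this
  -- can happen only off the closed strip, where nothing is required of `g`.
  set g : ℂ → (matrixCouple ι).Sum := fun z => Function.invFun (matrixCouple ι).toV (H z) with hg
  have hgV : ∀ z ∈ strip, (matrixCouple ι).toV (g z) = H z :=
    fun z hz => Function.invFun_eq (hex z hz)
  have hgV2 : ∀ z ∈ strip, ∀ w ∈ strip, (matrixCouple ι).toV (g z - g w) = H z - H w :=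
    fun z hz w hw => by rw [map_sub, hgV z hz, hgV w hw]
  have hglip : ∀ z ∈ strip, ∀ w ∈ strip, ‖g z - g w‖ ≤ 2 * M * ‖z - w‖ := by
    intro z hz w hw
    refine norm_sum_le_of_le hk hkl (K := ‖z - w‖₊) fun i j => ?_
    rw [hgV2 z hz w hw]
    exact hlip z hz w hw i j
  have hderiv : ∀ z ∈ openStrip, ∃ d, (matrixCouple ι).toV d =
      (fun i j => k i j * Complex.exp (l i j * z)) ∧ HasDerivAt g d z := by
    intro z hz
    obtain ⟨d, hd, -⟩ := exists_sum_of_le hk hkl (h := fun i j => k i j * Complex.exp (l i j * z))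
      (K := 1) fun i j => by
        rw [NNReal.coe_one, one_mul, norm_mul, norm_cexp_ofReal_mul]
        gcongr
        exact exp_mul_le _ hz.1.le hz.2.le
    refine ⟨d, hd, ?_⟩
    obtain ⟨δ, hδ, hδ₀, hδ₁⟩ : ∃ δ : ℝ, 0 < δ ∧ 2 * δ ≤ z.re ∧ z.re ≤ 1 - 2 * δ := by
      refine ⟨min z.re (1 - z.re) / 2, half_pos (lt_min hz.1 (sub_pos.2 hz.2)), ?_, ?_⟩
      · linarith [min_le_left z.re (1 - z.re)]
      · linarith [min_le_right z.re (1 - z.re)]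
    have hbound : ∀ w, ‖w - z‖ < δ →
        ‖g w - g z - (w - z) • d‖ ≤ 2 * M * (δ⁻¹ * ‖w - z‖ * ‖w - z‖) := by
      intro w hw
      have hws : w ∈ strip := by
        have h1 : |(w - z).re| ≤ ‖w - z‖ := Complex.abs_re_le_norm _
        rw [Complex.sub_re, abs_le] at h1
        constructor <;> linarith [h1.1, h1.2]
      have hδe : ((⟨δ⁻¹, by positivity⟩ * ‖w - z‖₊ * ‖w - z‖₊ : ℝ≥0) : ℝ) =
          δ⁻¹ * ‖w - z‖ * ‖w - z‖ := rfl
      rw [← hδe]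
      refine norm_sum_le_of_le hk hkl fun i j => ?_
      rw [map_sub, hgV2 w hws z (openStrip_subset_strip hz), map_smul, hd, hδe]
      change ‖H w i j - H z i j - (w - z) * (k i j * Complex.exp (l i j * z))‖ ≤ _
      have he : H w i j - H z i j - (w - z) * (k i j * Complex.exp (l i j * z)) =
          k i j * (expPrimitive (l i j) w - expPrimitive (l i j) z -
            (w - z) * Complex.exp (l i j * z)) := by
        rw [hHsub]; ring
      rw [he, norm_mul]
      have := norm_expPrimitive_sub_sub_le hδ hδ₀ hδ₁ (l i j) hw
      calc _ ≤ ‖k i j‖ * (δ⁻¹ * (1 + Real.exp (l i j)) * ‖w - z‖ * ‖w - z‖) := by gcongr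
        _ = _ := by ring
    rw [hasDerivAt_iff_isLittleO]
    have hO : (fun w => g w - g z - (w - z) • d) =O[𝓝 z] fun w => ‖w - z‖ * ‖w - z‖ := by
      refine Asymptotics.IsBigO.of_bound (2 * M * δ⁻¹) ?_
      filter_upwards [Metric.ball_mem_nhds z hδ] with w hw
      refine (hbound w (mem_ball_iff_norm.1 hw)).trans (le_of_eq ?_)
      rw [Real.norm_of_nonneg (by positivity)]; ring
    refine hO.trans_isLittleO ?_
    have h1 : (fun w : ℂ => ‖w - z‖) =o[𝓝 z] fun _ => (1 : ℝ) := by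
      rw [Asymptotics.isLittleO_one_iff]
      have : Continuous fun w : ℂ => ‖w - z‖ := by fun_prop
      simpa using this.tendsto z
    have h2 : (fun w : ℂ => ‖w - z‖) =O[𝓝 z] fun w => w - z :=
      (Asymptotics.isBigO_refl _ _).norm_left
    simpa using h1.mul_isBigO h2.norm_right
  refine ⟨g, ⟨?_, ?_, ?_, ?_, ?_⟩, ?_⟩
  · exact (LipschitzOnWith.of_dist_le_mul (K := 2 * M) fun z hz w hw => by
      rw [dist_eq_norm, dist_eq_norm]; push_cast; exact hglip z hz w hw).continuousOn
  · intro z hz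
    obtain ⟨d, -, hd⟩ := hderiv z hz
    exact hd.differentiableAt.differentiableWithinAt
  · refine ⟨2 * M + ‖g 0‖, fun z hz => ?_⟩
    have h1 := hglip z hz 0 h0s
    rw [sub_zero] at h1
    have h2 : ‖g z‖ ≤ ‖g z - g 0‖ + ‖g 0‖ := by
      simpa using norm_add_le (g z - g 0) (g 0)
    have h3 : 0 ≤ ‖g 0‖ * ‖z‖ := by positivity
    have h4 : (0 : ℝ) ≤ M := M.2
    nlinarith
  -- On $\mathrm{Re}\,z=0$ the derivative $e^{lz}$ has modulus $1$, so the increment is entrywise at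
  -- most $|k_{ij}||s-t|$ and lies in $A_0$ with the sharp constant $M$, without the factor $2$ of
  -- the sum norm. On $\mathrm{Re}\,z=1$ the modulus is $e^l$ and the columns of $ke^l$ play this
  -- role.
  · intro s t
    have hs : ∀ s : ℝ, (s * Complex.I : ℂ) ∈ {z : ℂ | z.re = 0} := fun s => by simp
    have hst : ∀ s : ℝ, (s * Complex.I : ℂ) ∈ strip := fun s => ⟨by simp, by simp⟩
    have hn : ‖(s * Complex.I : ℂ) - t * Complex.I‖ = |s - t| := by
      rw [← sub_mul, norm_mul, Complex.norm_I, mul_one, ← Complex.ofReal_sub, Complex.norm_real,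
        Real.norm_eq_abs]
    obtain ⟨x, hx, hxM⟩ := exists_ofRows hk (K := ‖(s * Complex.I : ℂ) - t * Complex.I‖₊)
      (h := H (s * Complex.I) - H (t * Complex.I)) fun i j => by
        change ‖H _ i j - H _ i j‖ ≤ _
        rw [hHsub, norm_mul, mul_comm, coe_nnnorm]
        gcongr
        refine (norm_expPrimitive_sub_le (convex_re_eq 0) (l := l i j) (B := 1)
          (fun v hv => ?_) (hs s) (hs t)).trans_eq (one_mul _)
        have hv : v.re = 0 := hv
        rw [hv]; simp
    refine ⟨x, (matrixCouple ι).toV_injective ?_, ?_⟩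
    · rw [toV_inl, hgV2 _ (hst s) _ (hst t)]; exact hx
    · rw [coe_nnnorm, hn] at hxM; linarith
  · intro s t
    have hs : ∀ s : ℝ, (1 + s * Complex.I : ℂ) ∈ {z : ℂ | z.re = 1} := fun s => by simp
    have hst : ∀ s : ℝ, (1 + s * Complex.I : ℂ) ∈ strip := fun s => ⟨by simp, by simp⟩
    have hn : ‖(1 + s * Complex.I : ℂ) - (1 + t * Complex.I)‖ = |s - t| := by
      rw [add_sub_add_left_eq_sub, ← sub_mul, norm_mul, Complex.norm_I, mul_one,
        ← Complex.ofReal_sub, Complex.norm_real, Real.norm_eq_abs]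
    obtain ⟨x, hx, hxM⟩ := exists_ofCols hkl
      (K := ‖(1 + s * Complex.I : ℂ) - (1 + t * Complex.I)‖₊)
      (h := H (1 + s * Complex.I) - H (1 + t * Complex.I)) fun i j => by
        change ‖H _ i j - H _ i j‖ ≤ _
        rw [hHsub, norm_mul, norm_mul, coe_nnnorm, Complex.norm_real,
          Real.norm_of_nonneg (Real.exp_pos _).le]
        have := norm_expPrimitive_sub_le (convex_re_eq 1) (l := l i j) (B := Real.exp (l i j))
          (fun v hv => ?_) (hs s) (hs t)
        · calc _ ≤ ‖k i j‖ * (Real.exp (l i j) *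
                ‖(1 + s * Complex.I : ℂ) - (1 + t * Complex.I)‖) := by gcongr
            _ = _ := by ring
        · have hv : v.re = 1 := hv
          rw [hv]; simp
    refine ⟨x, (matrixCouple ι).toV_injective ?_, ?_⟩
    · rw [toV_inr, hgV2 _ (hst s) _ (hst t)]; exact hx
    · rw [coe_nnnorm, hn] at hxM; linarith
  · intro z hz
    obtain ⟨d, hd, hdd⟩ := hderiv z hz
    rw [hdd.deriv, hd]

theorem upperENorm_le_productENorm (h₀ : 0 < θ) (h₁ : θ < 1) (a : Matrix ι ι ℂ) :
    (matrixCouple ι).upperENorm θ a ≤ productENorm ι θ a := by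
  refine le_of_forall_gt fun c hc => ?_
  obtain ⟨M, hM, hMc⟩ := ENNReal.lt_iff_exists_nnreal_btwn.1 hc
  obtain ⟨k, l, hk, hkl, ha⟩ := exists_exponential_family h₀ h₁ hM
  obtain ⟨g, hg, hgd⟩ := exists_isUpperRep hk hkl
  refine lt_of_le_of_lt (iInf_le_of_le g (iInf_le_of_le M (iInf_le_of_le hg
    (iInf_le_of_le ?_ le_rfl)))) hMc
  rw [hgd θ ⟨by simpa using h₀, by simpa using h₁⟩]
  ext i j
  exact ha i j

end UpperBounds

/-! ### The first method for finite matrices: Gaussian regularization. -/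

section LowerMethod

open Filter Topology Set Couple

variable {ι : Type*} {θ : ℝ}

/-- The Gaussian factor `e^{δ(z² - θ²)}`. -/
def gaussFactor (δ θ : ℝ) (z : ℂ) : ℂ := Complex.exp (δ * (z ^ 2 - θ ^ 2))

theorem norm_gaussFactor (δ θ : ℝ) (z : ℂ) :
    ‖gaussFactor δ θ z‖ = Real.exp (δ * (z.re ^ 2 - z.im ^ 2 - θ ^ 2)) := by
  rw [gaussFactor, Complex.norm_exp]
  congr 1
  rw [← Complex.ofReal_pow, Complex.re_ofReal_mul, Complex.sub_re, Complex.ofReal_re, sq z,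
    Complex.mul_re]
  ring

theorem norm_gaussFactor_le {δ : ℝ} (hδ : 0 ≤ δ) (θ : ℝ) {z : ℂ} (hz₀ : 0 ≤ z.re) (hz₁ : z.re ≤ 1) :
    ‖gaussFactor δ θ z‖ ≤ Real.exp δ := by
  rw [norm_gaussFactor]
  refine Real.exp_le_exp.2 (mul_le_of_le_one_right hδ ?_)
  nlinarith [sq_nonneg z.im, sq_nonneg θ]

theorem tendsto_gaussFactor_line {δ : ℝ} (hδ : 0 < δ) (θ : ℝ) (r : ℝ) :
    Tendsto (fun t : ℝ => gaussFactor δ θ (r + t * Complex.I)) (cocompact ℝ) (𝓝 0) := by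
  rw [tendsto_zero_iff_norm_tendsto_zero]
  have h1 : ∀ t : ℝ, ‖gaussFactor δ θ (r + t * Complex.I)‖ =
      Real.exp (-(δ * ‖t‖ ^ 2 + -(δ * (r ^ 2 - θ ^ 2)))) := by
    intro t
    rw [norm_gaussFactor, Real.norm_eq_abs, sq_abs]
    congr 1
    simp
    ring
  simp only [h1]
  refine Real.tendsto_exp_neg_atTop_nhds_zero.comp (tendsto_atTop_add_const_right _ _ ?_)
  exact ((tendsto_pow_atTop two_ne_zero).comp
    (tendsto_norm_cocompact_atTop (E := ℝ))).const_mul_atTop hδ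

theorem rowENorm_ne_top [Finite ι] (a : Matrix ι ι ℂ) : rowENorm a ≠ ∞ := by
  cases nonempty_fintype ι
  refine ne_top_of_le_ne_top (b := ∑ i, ∑ j, ‖a i j‖ₑ) ?_ (iSup_le fun i => ?_)
  · exact ENNReal.sum_ne_top.2 fun i _ => ENNReal.sum_ne_top.2 fun j _ => enorm_ne_top
  · rw [tsum_fintype]
    exact Finset.single_le_sum (f := fun i => ∑ j, ‖a i j‖ₑ) (fun _ _ => zero_le)
      (Finset.mem_univ i)

/-- The exponential family need not decay along vertical lines. The factor
$e^{\delta(z^2-\theta^2)}$ makes it decay, equals $1$ at $\theta$, and costs at most $e^\delta$ on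
the strip; then $\delta\to0$. With finitely many entries, continuity and decay are checked entry by
entry through matrix units. -/
theorem lowerENorm_le_productENorm [Finite ι] (h₀ : 0 < θ) (h₁ : θ < 1) (a : Matrix ι ι ℂ) :
    (matrixCouple ι).lowerENorm θ a ≤ productENorm ι θ a := by
  classical
  cases nonempty_fintype ι
  refine le_of_forall_gt fun c hc => ?_
  obtain ⟨M, hM, hMc⟩ := ENNReal.lt_iff_exists_nnreal_btwn.1 hc
  refine lt_of_le_of_lt ?_ hMc
  obtain ⟨k, l, hk, hkl, ha⟩ := exists_exponential_family h₀ h₁ hM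
  choose R hR using fun i j : ι => (mem_rows (Matrix.single i j (1 : ℂ))).2 (rowENorm_ne_top _)
  -- By definition the column norm of a matrix is the row norm of its transpose.
  choose S hS using fun i j : ι => (mem_cols (Matrix.single i j (1 : ℂ))).2 (rowENorm_ne_top (Matrix.single i j (1 : ℂ)).transpose)
  have hsum : ∀ w : ι → ι → ℂ, ∑ i, ∑ j, w i j • Matrix.single i j (1 : ℂ) = Matrix.of w := by
    intro w
    conv_rhs => rw [Matrix.matrix_eq_sum_single (Matrix.of w)]
    refine Finset.sum_congr rfl fun i _ => Finset.sum_congr rfl fun j _ => ?_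
    rw [Matrix.smul_single]; simp
  have key : ∀ δ : ℝ, 0 < δ → (matrixCouple ι).lowerENorm θ a ≤ ENNReal.ofReal (Real.exp δ) * M := by
    intro δ hδ
    obtain ⟨K, hK⟩ : ∃ K : ℝ≥0, (K : ℝ) = Real.exp δ := ⟨⟨_, (Real.exp_pos δ).le⟩, rfl⟩
    set w : ℂ → ι → ι → ℂ := fun z i j => gaussFactor δ θ z * (k i j * Complex.exp (l i j * z))
      with hw
    have hwd : ∀ i j, Differentiable ℂ fun z => w z i j := fun i j => by
      simp only [hw, gaussFactor]; fun_prop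
    have hwn : ∀ z ∈ strip, ∀ i j, ‖w z i j‖ ≤ Real.exp δ * (‖k i j‖ * Real.exp (l i j * z.re)) := by
      intro z hz i j
      simp only [hw]
      rw [norm_mul, norm_mul, norm_cexp_ofReal_mul]
      gcongr
      exact norm_gaussFactor_le hδ.le θ hz.1 hz.2
    have hw0 : ∀ (r : ℝ) i j, Tendsto (fun t : ℝ => w (r + t * Complex.I) i j) (cocompact ℝ)
        (𝓝 0) := by
      intro r i j
      refine (tendsto_gaussFactor_line hδ θ r).zero_mul_isBoundedUnder_le ?_
      refine isBoundedUnder_of ⟨‖k i j‖ * Real.exp (l i j * r), fun t => ?_⟩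
      rw [Function.comp_apply, norm_mul, norm_cexp_ofReal_mul]
      simp
    -- The restriction to $\mathrm{Re}\,z=r$, with `E` the matrix units realized in $A_0$ or in
    -- $A_1$.
    set line : ℝ → (ι → ι → Families ι) → C₀(ℝ, Families ι) := fun r E =>
      { toFun := fun t => ∑ i, ∑ j, w (r + t * Complex.I) i j • E i j
        continuous_toFun := continuous_finsetSum _ fun i _ => continuous_finsetSum _ fun j _ =>
          ((hwd i j).continuous.comp (by fun_prop)).smul continuous_const
        zero_at_infty' := by
          have : Tendsto (fun t : ℝ => ∑ i, ∑ j, w (r + t * Complex.I) i j • E i j) (cocompact ℝ)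
              (𝓝 (∑ i : ι, ∑ j : ι, (0 : ℂ) • E i j)) :=
            tendsto_finsetSum _ fun i _ => tendsto_finsetSum _ fun j _ =>
              (hw0 r i j).smul_const (E i j)
          simpa using this }
    have hlineap : ∀ r E t, line r E t = ∑ i, ∑ j, w (r + t * Complex.I) i j • E i j :=
      fun _ _ _ => rfl
    set f : ℂ → (matrixCouple ι).Sum := fun z => ∑ i, ∑ j, w z i j • (matrixCouple ι).inl (R i j)
      with hf
    have hfV : ∀ z, (matrixCouple ι).toV (f z) = Matrix.of (w z) := by
      intro z
      simp only [hf, map_sum, map_smul, toV_inl]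
      rw [← hsum]
      exact Finset.sum_congr rfl fun i _ => Finset.sum_congr rfl fun j _ =>
        congrArg (w z i j • ·) (hR i j)
    have hrows : ∀ r t, ofRows (line r R t) = Matrix.of (w (r + t * Complex.I)) := by
      intro r t
      rw [hlineap]
      simp only [map_sum, map_smul, hR, hsum]
    have hcols : ∀ r t, ofCols (line r S t) = Matrix.of (w (r + t * Complex.I)) := by
      intro r t
      rw [hlineap]
      simp only [map_sum, map_smul, hS, hsum]
    have hfd : Differentiable ℂ f := by
      simp only [hf]
      exact Differentiable.fun_sum fun i _ => Differentiable.fun_sum fun j _ =>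
        (hwd i j).smul_const _
    have hrep : (matrixCouple ι).IsLowerRep f (line 0 R) (line 1 S) := by
      refine ⟨hfd.continuous.continuousOn, hfd.differentiableOn,
        ⟨2 * M * Real.exp δ, fun z hz => ?_⟩, fun t => ?_, fun t => ?_⟩
      · rw [← hK]
        refine norm_sum_le_of_le hk hkl fun i j => ?_
        rw [hfV, hK]
        refine (hwn z hz i j).trans ?_
        gcongr
        exact exp_mul_le _ hz.1 hz.2
      · refine (matrixCouple ι).toV_injective ?_
        rw [hfV, toV_inl]
        refine Eq.trans ?_ (hrows 0 t).symm
        simp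
      · refine (matrixCouple ι).toV_injective ?_
        rw [hfV, toV_inr]
        refine Eq.trans ?_ (hcols 1 t).symm
        simp
    have hnorm : ∀ (F : C₀(ℝ, Families ι)), (∀ t, ‖F t‖ ≤ Real.exp δ * M) →
        ‖F‖ₑ ≤ ENNReal.ofReal (Real.exp δ) * M := by
      intro F hF
      rw [← ENNReal.ofReal_coe_nnreal (p := M), ← ENNReal.ofReal_mul (Real.exp_pos δ).le,
        ← ofReal_norm]
      refine ENNReal.ofReal_le_ofReal ?_
      rw [← ZeroAtInftyContinuousMap.norm_toBCF_eq_norm]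
      exact (BoundedContinuousFunction.norm_le (by positivity)).2 hF
    refine iInf_le_of_le f (iInf_le_of_le _ (iInf_le_of_le _ (iInf_le_of_le hrep
      (iInf_le_of_le ?_ (max_le (hnorm _ fun t => ?_) (hnorm _ fun t => ?_))))))
    · rw [hfV]
      ext i j
      rw [← ha i j]
      simp [hw, gaussFactor]
    · obtain ⟨x, hx, hxM⟩ := exists_ofRows hk (K := K)
        (h := Matrix.of (w ((0 : ℝ) + t * Complex.I))) fun i j => by
          refine (hwn _ ⟨by simp, by simp⟩ i j).trans (le_of_eq ?_)
          rw [hK]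
          simp
      rw [← hrows] at hx
      rw [← (matrixCouple ι).inj₀ hx]
      exact hxM.trans_eq (by rw [hK])
    · obtain ⟨x, hx, hxM⟩ := exists_ofCols hkl (K := K)
        (h := Matrix.of (w ((1 : ℝ) + t * Complex.I))) fun i j => by
          refine (hwn _ ⟨by simp, by simp⟩ i j).trans (le_of_eq ?_)
          rw [norm_mul, Complex.norm_real, Real.norm_of_nonneg (Real.exp_pos _).le]
          rw [hK]
          simp
      rw [← hcols] at hx
      rw [← (matrixCouple ι).inj₁ hx]
      exact hxM.trans_eq (by rw [hK])
  have hlim : Tendsto (fun δ : ℝ => ENNReal.ofReal (Real.exp δ) * M) (𝓝[>] 0) (𝓝 M) := by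
    have h1 : Continuous fun δ : ℝ => ENNReal.ofReal (Real.exp δ) * M :=
      (ENNReal.continuous_mul_const ENNReal.coe_ne_top).comp
        (ENNReal.continuous_ofReal.comp Real.continuous_exp)
    have h2 := h1.tendsto 0
    simp only [Real.exp_zero, ENNReal.ofReal_one, one_mul] at h2
    exact h2.mono_left nhdsWithin_le_nhds
  exact ge_of_tendsto hlim (by
    filter_upwards [self_mem_nhdsWithin] with δ hδ using key δ hδ)

end LowerMethod

/-! ## Operators and their matrices -/

section MatrixOf

variable {ι κ E F : Type*} [NormedAddCommGroup E] [NormedSpace ℂ E]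
    [NormedAddCommGroup F] [NormedSpace ℂ F]

/-- The coordinates, as a linear map. -/
def coordsHom (ι : Type*) (p : ℝ≥0∞) : ell ι p →ₗ[ℂ] ι → ℂ where
  toFun := coords
  map_add' _ _ := rfl
  map_smul' _ _ := rfl

theorem coordsHom_injective (ι : Type*) (p : ℝ≥0∞) : Function.Injective (coordsHom ι p) :=
  fun _ _ h => lp.ext h

/-- The entries are forced to be the coordinates of $u(e_j)$; a continuous coordinate functional
composed with $u$ can be applied termwise to the expansion of $x$. -/
theorem existsUnique_isMatrixOf [DecidableEq ι] {cE : E → ι → ℂ} {cF : F → κ → ℂ} {e : ι → E}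
    (he : ∀ x, HasSum (fun j => cE x j • e j) x) (he' : ∀ j, cE (e j) = Pi.single j 1)
    (hF : ∀ i, ∃ φ : F →L[ℂ] ℂ, ∀ y, φ y = cF y i) (u : E →L[ℂ] F) :
    ∃! a, IsMatrixOf cE cF u a := by
  refine ⟨Matrix.of fun i j => cF (u (e j)) i, fun x i => ?_, fun b hb => ?_⟩
  · obtain ⟨φ, hφ⟩ := hF i
    have h := (he x).mapL (φ.comp u)
    simp only [ContinuousLinearMap.comp_apply, map_smul, hφ, smul_eq_mul] at h
    simpa [mul_comm] using h
  · ext i j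
    refine (hb (e j) i).unique ?_ |>.symm
    rw [he']
    have := hasSum_single (f := fun k => b i k * (Pi.single j 1 : ι → ℂ) k) j fun k hk => by
      simp [hk]
    simpa using this

theorem IsMatrixOf.operator_unique {cE : E → ι → ℂ} {cF : F → κ → ℂ}
    (hF : Function.Injective cF) {u v : E →L[ℂ] F} {a : Matrix κ ι ℂ} (hu : IsMatrixOf cE cF u a)
    (hv : IsMatrixOf cE cF v a) : u = v := by
  ext x
  exact hF (funext fun i => (hu x i).unique (hv x i))

/-- The images may be chosen vector by vector: uniqueness of sums and injectivity of the coordinates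
make the choice linear. -/
theorem exists_operator (cE : E →ₗ[ℂ] ι → ℂ) (cF : F →ₗ[ℂ] κ → ℂ) (hF : Function.Injective cF)
    {a : Matrix κ ι ℂ} {C : ℝ}
    (h : ∀ x, ∃ y, (∀ i, HasSum (fun j => a i j * cE x j) (cF y i)) ∧ ‖y‖ ≤ C * ‖x‖) :
    ∃ u : E →L[ℂ] F, IsMatrixOf cE cF u a ∧ ∀ x, ‖u x‖ ≤ C * ‖x‖ := by
  choose f hf hfC using h
  refine ⟨LinearMap.mkContinuous
    { toFun := f
      map_add' := fun x y => hF (funext fun i => ?_)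
      map_smul' := fun r x => hF (funext fun i => ?_) } C hfC, fun x i => hf x i, hfC⟩
  · refine (hf (x + y) i).unique ?_
    rw [map_add, map_add]
    simpa [mul_add] using (hf x i).add (hf y i)
  · refine (hf (r • x) i).unique ?_
    rw [map_smul, map_smul]
    simpa [mul_left_comm] using (hf x i).mul_left r

theorem exists_coordinate (ι : Type*) (p : ℝ≥0∞) [Fact (1 ≤ p)] (i : ι) :
    ∃ φ : ell ι p →L[ℂ] ℂ, ∀ y, φ y = coords y i :=
  ⟨LinearMap.mkContinuous ((LinearMap.proj i).comp (coordsHom ι p)) 1 fun x => by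
      rw [one_mul]
      exact lp.norm_apply_le_norm (zero_lt_one.trans_le Fact.out).ne' x i, fun _ => rfl⟩

theorem hasSum_coords_single [DecidableEq ι] {p : ℝ≥0∞} [Fact (1 ≤ p)] (hp : p ≠ ∞)
    (x : ell ι p) :
    HasSum (fun j => coords x j • (lp.single p j (1 : ℂ) : ell ι p)) x := by
  have h : (fun j => coords x j • (lp.single p j (1 : ℂ) : ell ι p)) =
      fun j => lp.single p j (x j) := funext fun j => by
    rw [← lp.single_smul, smul_eq_mul, mul_one]; rfl
  rw [h]
  exact lp.hasSum_single hp x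

theorem coords_single [DecidableEq ι] {p : ℝ≥0∞} (j : ι) :
    coords (lp.single p j (1 : ℂ) : ell ι p) = Pi.single j 1 :=
  lp.coeFn_single p j 1

end MatrixOf

/-! ### Regular norm, norm of the absolute matrix, and Schur bounds on $\ell_p$. -/

section RegularOperators

variable {ι : Type*} {p : ℝ≥0∞} {θ : ℝ}

theorem enorm_rpow_lp [Fact (1 ≤ p)] {E : Type*} [NormedAddCommGroup E] (hp : 0 < p.toReal)
    (y : lp (fun _ : ι => E) p) : ‖y‖ₑ ^ p.toReal = ∑' i, ‖y i‖ₑ ^ p.toReal := by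
  have hs : Summable fun i => ‖y i‖ ^ p.toReal := (lp.memℓp y).summable hp
  rw [← ofReal_norm, ENNReal.ofReal_rpow_of_nonneg (norm_nonneg _) hp.le,
    lp.norm_rpow_eq_tsum hp, ENNReal.ofReal_tsum_of_nonneg (fun _ => by positivity) hs]
  refine tsum_congr fun i => ?_
  rw [← ENNReal.ofReal_rpow_of_nonneg (norm_nonneg _) hp.le, ofReal_norm]

theorem memℓp_of_tsum_ne_top {E : Type*} [NormedAddCommGroup E] {f : ι → E} (h : ∑' i, ‖f i‖ₑ ^ p.toReal ≠ ∞) : Memℓp f p := by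
  refine memℓp_gen ?_
  have := ENNReal.summable_toReal h
  simpa [← ENNReal.toReal_rpow] using this

theorem enorm_of_hasSum_coe {r : ι → ℝ≥0} {s : ℂ} (h : HasSum (fun j => ((r j : ℝ) : ℂ)) s) :
    ‖s‖ₑ = ∑' j, (r j : ℝ≥0∞) := by
  have h1 : Summable fun j => (r j : ℝ) := Complex.summable_ofReal.1 h.summable
  have h2 : Summable r := NNReal.summable_coe.1 h1
  have h3 : s = (((∑' j, r j : ℝ≥0) : ℝ) : ℂ) := by
    rw [← h.tsum_eq, NNReal.coe_tsum, Complex.ofReal_tsum]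
  rw [h3, ← ENNReal.coe_tsum h2, enorm_eq_nnnorm, Complex.nnnorm_real,
    Real.nnnorm_of_nonneg NNReal.zero_le_coe]
  rfl

theorem enorm_le_of_hasSum {f : ι → ℂ} {s : ℂ} (h : HasSum f s) : ‖s‖ₑ ≤ ∑' j, ‖f j‖ₑ :=
  le_of_tendsto' (Filter.Tendsto.enorm h) fun J =>
    (enorm_sum_le J f).trans (ENNReal.sum_le_tsum J)

theorem summable_of_tsum_enorm_ne_top {f : ι → ℂ} (h : ∑' j, ‖f j‖ₑ ≠ ∞) : Summable f := by
  refine Summable.of_norm ?_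
  simpa using ENNReal.summable_toReal h

/-- The smallest Schur bound of the matrix `(|a_ij|)`. -/
def schurENorm (θ : ℝ) (a : Matrix ι ι ℂ) : ℝ≥0∞ :=
  ⨅ (C : ℝ≥0) (_ : IsSchurBound θ (fun i j => ‖a i j‖₊) C), (C : ℝ≥0∞)

variable [Fact (1 ≤ p)] {a : Matrix ι ι ℂ} {C : ℝ≥0}

theorem exists_operator_of_isSchurBound (h₀ : 0 < θ) (hp : p.toReal = θ⁻¹)
    (h : IsSchurBound θ (fun i j => ‖a i j‖₊) C) :
    ∃ u : ell ι p →L[ℂ] ell ι p, IsMatrixOf coords coords u a ∧ ‖u‖ ≤ C := by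
  have hinv : 0 < θ⁻¹ := inv_pos.2 h₀
  have hp0 : 0 < p.toReal := hp ▸ hinv
  obtain ⟨u, hu, huC⟩ := exists_operator (coordsHom ι p) (coordsHom ι p) (coordsHom_injective ι p)
    (a := a) (C := C) fun x => by
      have hx : ∑' j, ‖x j‖ₑ ^ θ⁻¹ = ‖x‖ₑ ^ θ⁻¹ := by rw [← hp, enorm_rpow_lp hp0]
      have hxt : ‖x‖ₑ ^ θ⁻¹ ≠ ∞ := (ENNReal.rpow_lt_top_of_nonneg hinv.le enorm_ne_top).ne
      have key := h.tsum_rpow_le h₀ (fun j => ‖x j‖ₑ) (by rwa [hx])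
      rw [hx] at key
      have hCt : (C : ℝ≥0∞) ^ θ⁻¹ * ‖x‖ₑ ^ θ⁻¹ ≠ ∞ :=
        ENNReal.mul_ne_top (ENNReal.rpow_lt_top_of_nonneg hinv.le ENNReal.coe_ne_top).ne hxt
      have hfin : ∀ i, ∑' j, ‖a i j * x j‖ₑ ≠ ∞ := fun i hi => by
        have h1 := ENNReal.ne_top_of_tsum_ne_top (ne_top_of_le_ne_top hCt key) i
        simp only [enorm_mul] at hi
        change (∑' j, ‖a i j‖ₑ * ‖x j‖ₑ) ^ θ⁻¹ ≠ ∞ at h1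
        rw [hi, ENNReal.top_rpow_of_pos hinv] at h1
        exact h1 rfl
      set y : ι → ℂ := fun i => ∑' j, a i j * x j with hy
      have hys : ∀ i, HasSum (fun j => a i j * x j) (y i) := fun i =>
        (summable_of_tsum_enorm_ne_top (hfin i)).hasSum
      have hyle : ∑' i, ‖y i‖ₑ ^ θ⁻¹ ≤ (C : ℝ≥0∞) ^ θ⁻¹ * ‖x‖ₑ ^ θ⁻¹ := by
        refine le_trans (ENNReal.tsum_le_tsum fun i => ?_) key
        refine ENNReal.rpow_le_rpow ((enorm_le_of_hasSum (hys i)).trans (le_of_eq ?_)) hinv.le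
        simp only [enorm_mul]; rfl
      have hym : Memℓp y p := memℓp_of_tsum_ne_top (by
        rw [hp]; exact ne_top_of_le_ne_top hCt hyle)
      refine ⟨⟨y, hym⟩, hys, ?_⟩
      have h1 : ‖(⟨y, hym⟩ : ell ι p)‖ₑ ^ θ⁻¹ ≤ (C * ‖x‖ₑ) ^ θ⁻¹ := by
        rw [ENNReal.mul_rpow_of_nonneg _ _ hinv.le]
        refine le_trans (le_of_eq ?_) hyle
        rw [← hp, enorm_rpow_lp hp0]
      have h2 := (ENNReal.rpow_le_rpow_iff hinv).1 h1
      simp only [enorm_eq_nnnorm] at h2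
      exact_mod_cast h2
  exact ⟨u, hu, u.opNorm_le_bound C.2 huC⟩

/-- On nonnegative vectors the series of a nonnegative matrix have no cancellation, so the norm of
$v$ controls $\sum_j|a_{ij}|x_j$ itself. -/
theorem isSchurBound_of_isMatrixOf_absMatrix (h₀ : 0 < θ) (h₁ : θ < 1) (hp : p.toReal = θ⁻¹)
    {v : ell ι p →L[ℂ] ell ι p} (hv : IsMatrixOf coords coords v (absMatrix a)) :
    IsSchurBound θ (fun i j => ‖a i j‖₊) ‖v‖₊ := by
  have hinv : 0 < θ⁻¹ := inv_pos.2 h₀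
  have hp0 : 0 < p.toReal := hp ▸ hinv
  refine isSchurBound_of_rpow_le h₀ h₁ fun x hx I => ?_
  have hfin : ∀ j, x j ≠ ∞ := fun j hj => ENNReal.ne_top_of_tsum_ne_top hx j (by
    simp [hj, hinv])
  lift x to ι → ℝ≥0 using hfin
  have hen : ∀ j, ‖((x j : ℝ) : ℂ)‖ₑ = x j := fun j => by
    rw [enorm_eq_nnnorm, Complex.nnnorm_real, Real.nnnorm_of_nonneg NNReal.zero_le_coe]; rfl
  have hxm : Memℓp (fun j => ((x j : ℝ) : ℂ)) p := memℓp_of_tsum_ne_top (by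
    simp only [hen, hp]; exact hx)
  set X : ell ι p := ⟨fun j => ((x j : ℝ) : ℂ), hxm⟩ with hX
  have hXn : ‖X‖ₑ ^ θ⁻¹ = ∑' j, (x j : ℝ≥0∞) ^ θ⁻¹ := by
    rw [← hp, enorm_rpow_lp hp0]
    exact tsum_congr fun j => congrArg (· ^ p.toReal) (hen j)
  have hvX : ∀ i, ‖v X i‖ₑ = ∑' j, (‖a i j‖₊ : ℝ≥0∞) * x j := fun i => by
    have h1 : HasSum (fun j => (((‖a i j‖₊ * x j : ℝ≥0) : ℝ) : ℂ)) (v X i) := by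
      have h : (fun j => (((‖a i j‖₊ * x j : ℝ≥0) : ℝ) : ℂ)) =
          fun j => absMatrix a i j * coords X j := funext fun j => by
        change _ = (‖a i j‖ : ℂ) * ((x j : ℝ) : ℂ)
        push_cast; rfl
      rw [h]
      exact hv X i
    rw [enorm_of_hasSum_coe h1]
    push_cast; rfl
  calc ∑ i ∈ I, (∑' j, (‖a i j‖₊ : ℝ≥0∞) * x j) ^ θ⁻¹ = ∑ i ∈ I, ‖v X i‖ₑ ^ θ⁻¹ := by
        simp only [hvX]
    _ ≤ ∑' i, ‖v X i‖ₑ ^ θ⁻¹ := ENNReal.sum_le_tsum I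
    _ = ‖v X‖ₑ ^ θ⁻¹ := by rw [← hp, enorm_rpow_lp hp0]
    _ ≤ (‖v‖ₑ * ‖X‖ₑ) ^ θ⁻¹ := ENNReal.rpow_le_rpow (v.le_opENorm X) hinv.le
    _ = _ := by rw [ENNReal.mul_rpow_of_nonneg _ _ hinv.le, hXn]; rfl

/-- Pointwise $\sup_k|u(x_k)|\le|a|\sup_k|x_k|$, and the Schur bound controls the right side in
$\ell_p$. -/
theorem isRegularBound_of_isSchurBound (h₀ : 0 < θ) (hp : p.toReal = θ⁻¹)
    {u : ell ι p →L[ℂ] ell ι p} (hu : IsMatrixOf coords coords u a)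
    (h : IsSchurBound θ (fun i j => ‖a i j‖₊) C) : IsRegularBound u C := by
  have hinv : 0 < θ⁻¹ := inv_pos.2 h₀
  have hp0 : 0 < p.toReal := hp ▸ hinv
  intro m x
  have hsup : ∑' j, ‖supAbs x j‖ₑ ^ θ⁻¹ = ‖supAbs x‖ₑ ^ θ⁻¹ := by rw [← hp, enorm_rpow_lp hp0]
  have key := h.tsum_rpow_le h₀ (fun j => ‖supAbs x j‖ₑ) (by
    rw [hsup]; exact (ENNReal.rpow_lt_top_of_nonneg hinv.le enorm_ne_top).ne)
  have hle : ∀ k j, ‖x k j‖ₑ ≤ ‖supAbs x j‖ₑ := fun k j => by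
    rw [← ofReal_norm, ← ofReal_norm]
    refine ENNReal.ofReal_le_ofReal (le_trans ?_ (le_abs_self _))
    exact le_ciSup (f := fun k => ‖x k j‖) (Set.finite_range _).bddAbove k
  have hpt : ∀ i, ‖supAbs (fun k => u (x k)) i‖ₑ ≤
      ∑' j, (‖a i j‖₊ : ℝ≥0∞) * ‖supAbs x j‖ₑ := by
    intro i
    rcases eq_or_ne (∑' j, (‖a i j‖₊ : ℝ≥0∞) * ‖supAbs x j‖ₑ) ∞ with ht | ht
    · rw [ht]; exact le_top
    · rw [← ofReal_norm]
      change ENNReal.ofReal ‖⨆ k, ‖u (x k) i‖‖ ≤ _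
      rw [Real.norm_of_nonneg (Real.iSup_nonneg fun k => norm_nonneg _)]
      refine ENNReal.ofReal_le_of_le_toReal (Real.iSup_le (fun k => ?_) ENNReal.toReal_nonneg)
      rw [← toReal_enorm]
      refine ENNReal.toReal_mono ht ((enorm_le_of_hasSum (hu (x k) i)).trans ?_)
      refine ENNReal.tsum_le_tsum fun j => ?_
      rw [enorm_mul]
      exact mul_le_mul' le_rfl (hle k j)
  have h1 : ‖supAbs fun k => u (x k)‖ₑ ^ θ⁻¹ ≤ (C * ‖supAbs x‖ₑ) ^ θ⁻¹ := by
    rw [ENNReal.mul_rpow_of_nonneg _ _ hinv.le, ← hsup, ← hp, enorm_rpow_lp hp0, hp]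
    exact (ENNReal.tsum_le_tsum fun i => ENNReal.rpow_le_rpow (hpt i) hinv.le).trans key
  have h2 := (ENNReal.rpow_le_rpow_iff hinv).1 h1
  simp only [enorm_eq_nnnorm] at h2
  exact_mod_cast h2

theorem isSchurBound_of_isRegularBound (h₀ : 0 < θ) (h₁ : θ < 1) (hp : p.toReal = θ⁻¹)
    {u : ell ι p →L[ℂ] ell ι p} (hu : IsMatrixOf coords coords u a) (h : IsRegularBound u C) :
    IsSchurBound θ (fun i j => ‖a i j‖₊) C := by
  have hinv : 0 < θ⁻¹ := inv_pos.2 h₀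
  have hp0 : 0 < p.toReal := hp ▸ hinv
  refine isSchurBound_of_rpow_le h₀ h₁ fun x hx I => ?_
  have hfin : ∀ j, x j ≠ ∞ := fun j hj => ENNReal.ne_top_of_tsum_ne_top hx j (by
    simp [hj, hinv])
  lift x to ι → ℝ≥0 using hfin
  choose ε hε1 hε using fun i j => RCLike.exists_norm_eq_mul_self (a i j)
  have hno : ∀ i j, ‖ε i j * ((x j : ℝ) : ℂ)‖ = x j := fun i j => by
    rw [norm_mul, hε1, one_mul, Complex.norm_real, Real.norm_of_nonneg NNReal.zero_le_coe]
  have hen : ∀ i j, ‖ε i j * ((x j : ℝ) : ℂ)‖ₑ = x j := fun i j => by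
    rw [← ofReal_norm, hno, ENNReal.ofReal_coe_nnreal]
  have hxm : ∀ i, Memℓp (fun j => ε i j * ((x j : ℝ) : ℂ)) p := fun i =>
    memℓp_of_tsum_ne_top (by simp only [hen, hp]; exact hx)
  -- One test vector per row: all have modulus $x$, so their supremum is at most $x$, while the
  -- phases make coordinate $i$ of $u(X_i)$ equal to $\sum_j|a_{ij}|x_j$. Only rows in the finite
  -- set `I` enter, as regularity concerns finite families.
  set X : ι → ell ι p := fun i => ⟨fun j => ε i j * ((x j : ℝ) : ℂ), hxm i⟩ with hX
  have huX : ∀ i, ‖u (X i) i‖ₑ = ∑' j, (‖a i j‖₊ : ℝ≥0∞) * x j := fun i => by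
    have h1 : HasSum (fun j => (((‖a i j‖₊ * x j : ℝ≥0) : ℝ) : ℂ)) (u (X i) i) := by
      have h : (fun j => (((‖a i j‖₊ * x j : ℝ≥0) : ℝ) : ℂ)) =
          fun j => a i j * coords (X i) j := funext fun j => by
        change _ = a i j * (ε i j * ((x j : ℝ) : ℂ))
        rw [← mul_assoc, mul_comm (a i j), ← hε]
        push_cast; rfl
      rw [h]
      exact hu (X i) i
    rw [enorm_of_hasSum_coe h1]
    push_cast; rfl
  set Z : Fin I.card → ell ι p := fun k => X (I.equivFin.symm k) with hZ
  have hZn : ‖supAbs Z‖ₑ ^ θ⁻¹ ≤ ∑' j, (x j : ℝ≥0∞) ^ θ⁻¹ := by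
    rw [← hp, enorm_rpow_lp hp0]
    refine ENNReal.tsum_le_tsum fun j => ENNReal.rpow_le_rpow ?_ hp0.le
    rw [← ofReal_norm]
    change ENNReal.ofReal ‖⨆ k, ‖Z k j‖‖ ≤ _
    rw [Real.norm_of_nonneg (Real.iSup_nonneg fun k => norm_nonneg _),
      ← ENNReal.ofReal_coe_nnreal (p := x j)]
    exact ENNReal.ofReal_le_ofReal (Real.iSup_le (fun k => (hno _ j).le) NNReal.zero_le_coe)
  have hle : ∀ i ∈ I, ‖u (X i) i‖ₑ ≤ ‖supAbs (fun k => u (Z k)) i‖ₑ := fun i hi => by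
    rw [← ofReal_norm, ← ofReal_norm]
    refine ENNReal.ofReal_le_ofReal (le_trans ?_ (le_abs_self _))
    have := le_ciSup (f := fun k => ‖u (Z k) i‖) (Set.finite_range _).bddAbove (I.equivFin ⟨i, hi⟩)
    simp only [hZ, Equiv.symm_apply_apply] at this
    exact this
  have hreg : ‖supAbs fun k => u (Z k)‖ₑ ≤ C * ‖supAbs Z‖ₑ := by
    simp only [enorm_eq_nnnorm]
    exact_mod_cast h _ Z
  calc ∑ i ∈ I, (∑' j, (‖a i j‖₊ : ℝ≥0∞) * x j) ^ θ⁻¹ = ∑ i ∈ I, ‖u (X i) i‖ₑ ^ θ⁻¹ := by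
        simp only [huX]
    _ ≤ ∑ i ∈ I, ‖supAbs (fun k => u (Z k)) i‖ₑ ^ θ⁻¹ :=
        Finset.sum_le_sum fun i hi => ENNReal.rpow_le_rpow (hle i hi) hinv.le
    _ ≤ ∑' i, ‖supAbs (fun k => u (Z k)) i‖ₑ ^ θ⁻¹ := ENNReal.sum_le_tsum I
    _ = ‖supAbs fun k => u (Z k)‖ₑ ^ θ⁻¹ := by rw [← hp, enorm_rpow_lp hp0]
    _ ≤ (C * ‖supAbs Z‖ₑ) ^ θ⁻¹ := ENNReal.rpow_le_rpow hreg hinv.le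
    _ ≤ _ := by rw [ENNReal.mul_rpow_of_nonneg _ _ hinv.le]; gcongr

theorem regENorm_eq_schurENorm (h₀ : 0 < θ) (h₁ : θ < 1) (hp : p.toReal = θ⁻¹)
    {u : ell ι p →L[ℂ] ell ι p} (hu : IsMatrixOf coords coords u a) :
    regENorm u = schurENorm θ a :=
  le_antisymm
    (le_iInf₂ fun _ hC => iInf₂_le _ (isRegularBound_of_isSchurBound h₀ hp hu hC))
    (le_iInf₂ fun _ hC => iInf₂_le _ (isSchurBound_of_isRegularBound h₀ h₁ hp hu hC))

theorem opENorm_absMatrix_eq_schurENorm (h₀ : 0 < θ) (h₁ : θ < 1) (hp : p.toReal = θ⁻¹)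
    (a : Matrix ι ι ℂ) : opENorm p (absMatrix a) = schurENorm θ a := by
  refine le_antisymm (le_iInf₂ fun C hC => ?_) (le_iInf₂ fun v hv =>
    iInf₂_le _ (isSchurBound_of_isMatrixOf_absMatrix h₀ h₁ hp hv))
  have hC' : IsSchurBound θ (fun i j => ‖absMatrix a i j‖₊) C := by
    have : (fun i j => ‖absMatrix a i j‖₊) = fun i j => ‖a i j‖₊ := by
      ext i j; simp [absMatrix]
    rwa [this]
  obtain ⟨v, hv, hvC⟩ := exists_operator_of_isSchurBound (p := p) h₀ hp hC'
  refine (iInf₂_le v hv).trans ?_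
  rw [enorm_eq_nnnorm]
  exact_mod_cast hvC

theorem isometricIdentity_regENorm (h₀ : 0 < θ) (h₁ : θ < 1) (hp : p.toReal = θ⁻¹)
    {N : Matrix ι ι ℂ → ℝ≥0∞} (hN : ∀ a, N a = schurENorm θ a) :
    IsometricIdentity (E := ell ι p) (F := ell ι p) coords coords regENorm N := by
  classical
  have hpt : p ≠ ∞ := by
    rintro rfl
    exact (inv_pos.2 h₀).ne' hp.symm
  refine ⟨fun u _ => ?_, fun a ha => ?_, fun u a hu => ?_⟩
  · exact existsUnique_isMatrixOf (cE := coords) (cF := coords)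
      (e := fun j => lp.single p j (1 : ℂ)) (hasSum_coords_single hpt) coords_single
      (exists_coordinate ι p) u
  · rw [hN, schurENorm] at ha
    obtain ⟨C, hC⟩ : ∃ C, IsSchurBound θ (fun i j => ‖a i j‖₊) C := by
      by_contra! hcon
      exact ha (by simp [hcon])
    obtain ⟨u, hu, -⟩ := exists_operator_of_isSchurBound (p := p) h₀ hp hC
    exact ⟨u, hu, fun v hv => hv.operator_unique (coordsHom_injective ι p) hu⟩
  · rw [hN, regENorm_eq_schurENorm h₀ h₁ hp hu]

end RegularOperators

/-! ### The cycle of inequalities between the product, interpolation and Schur norms. -/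

section InterpolationNorms

open Couple

variable {ι : Type*} {θ : ℝ}

theorem productENorm_le_schurENorm [Countable ι] (h₀ : 0 < θ) (h₁ : θ < 1) (a : Matrix ι ι ℂ) :
    productENorm ι θ a ≤ schurENorm θ a :=
  le_iInf₂ fun _ hC => productENorm_le_of_isSchurBound h₀ h₁ hC

theorem schurENorm_le_upperENorm (h₀ : 0 < θ) (h₁ : θ < 1) (a : Matrix ι ι ℂ) :
    schurENorm θ a ≤ (matrixCouple ι).upperENorm θ a := by
  refine le_iInf₂ fun g M => le_iInf₂ fun hg ha => ?_
  subst ha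
  exact iInf₂_le _ (isSchurBound_of_isUpperRep h₀ h₁ hg)

theorem schurENorm_le_lowerENorm (h₀ : 0 < θ) (h₁ : θ < 1) (a : Matrix ι ι ℂ) :
    schurENorm θ a ≤ (matrixCouple ι).lowerENorm θ a := by
  refine le_iInf₂ fun f f₀ => le_iInf₂ fun f₁ hf => le_iInf fun ha => ?_
  subst ha
  refine (iInf₂_le _ (isSchurBound_of_isLowerRep h₀ h₁ hf)).trans (le_of_eq ?_)
  rw [ENNReal.coe_max]; rfl

theorem productENorm_eq_schurENorm [Countable ι] (h₀ : 0 < θ) (h₁ : θ < 1) (a : Matrix ι ι ℂ) :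
    productENorm ι θ a = schurENorm θ a :=
  le_antisymm (productENorm_le_schurENorm h₀ h₁ a)
    ((schurENorm_le_upperENorm h₀ h₁ a).trans (upperENorm_le_productENorm h₀ h₁ a))

theorem upperENorm_eq_schurENorm [Countable ι] (h₀ : 0 < θ) (h₁ : θ < 1) (a : Matrix ι ι ℂ) :
    (matrixCouple ι).upperENorm θ a = schurENorm θ a :=
  le_antisymm ((upperENorm_le_productENorm h₀ h₁ a).trans (productENorm_le_schurENorm h₀ h₁ a))
    (schurENorm_le_upperENorm h₀ h₁ a)

theorem lowerENorm_eq_schurENorm [Finite ι] (h₀ : 0 < θ) (h₁ : θ < 1) (a : Matrix ι ι ℂ) :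
    (matrixCouple ι).lowerENorm θ a = schurENorm θ a :=
  le_antisymm ((lowerENorm_le_productENorm h₀ h₁ a).trans (productENorm_le_schurENorm h₀ h₁ a))
    (schurENorm_le_lowerENorm h₀ h₁ a)

end InterpolationNorms

/-! ## Operators whose norm is the row or the column norm -/

section RowAndColumnNorms

variable {ι : Type*} {a : Matrix ι ι ℂ} {C : ℝ≥0}

section Rows

variable {E : Type*} [NormedAddCommGroup E] [NormedSpace ℂ E] (cE : E →ₗ[ℂ] ι → ℂ)

theorem exists_operator_of_rowENorm_le (hcoord : ∀ x j, ‖cE x j‖ ≤ ‖x‖) (h : rowENorm a ≤ C) :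
    ∃ u : E →L[ℂ] ell ι ∞, IsMatrixOf cE coords u a ∧ ‖u‖ ≤ C := by
  obtain ⟨u, hu, huC⟩ := exists_operator cE (coordsHom ι ∞) (coordsHom_injective ι ∞)
    (a := a) (C := C) fun x => by
      have hle : ∀ i, ∑' j, ‖a i j * cE x j‖ₑ ≤ C * ‖x‖ₑ := fun i => by
        calc ∑' j, ‖a i j * cE x j‖ₑ ≤ ∑' j, ‖a i j‖ₑ * ‖x‖ₑ := by
              refine ENNReal.tsum_le_tsum fun j => ?_
              rw [enorm_mul]
              exact mul_le_mul' le_rfl (enorm_le_iff_norm_le.2 (hcoord x j))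
          _ = (∑' j, ‖a i j‖ₑ) * ‖x‖ₑ := ENNReal.tsum_mul_right
          _ ≤ C * ‖x‖ₑ := by gcongr; exact (le_iSup (fun i => ∑' j, ‖a i j‖ₑ) i).trans h
      set y : ι → ℂ := fun i => ∑' j, a i j * cE x j with hy
      have hys : ∀ i, HasSum (fun j => a i j * cE x j) (y i) := fun i =>
        (summable_of_tsum_enorm_ne_top (ne_top_of_le_ne_top
          (ENNReal.mul_ne_top ENNReal.coe_ne_top enorm_ne_top) (hle i))).hasSum
      have hyle : ∀ i, ‖y i‖ ≤ C * ‖x‖ := fun i => by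
        have := (enorm_le_of_hasSum (hys i)).trans (hle i)
        simp only [enorm_eq_nnnorm] at this
        exact_mod_cast this
      have hym : Memℓp y ∞ := memℓp_infty ⟨C * ‖x‖, by rintro _ ⟨i, rfl⟩; exact hyle i⟩
      exact ⟨⟨y, hym⟩, hys, lp.norm_le_of_forall_le (by positivity) hyle⟩
  exact ⟨u, hu, u.opNorm_le_bound C.2 huC⟩

/-- A finite combination of basis vectors with unimodular coefficients lies in the unit ball of a
supremum norm; phases adapted to row $i$ produce the partial sum of $|a_{ij}|$ over `J`. -/
theorem rowENorm_le_of_isMatrixOf [DecidableEq ι] {e : ι → E} (he : ∀ j, cE (e j) = Pi.single j 1)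
    (hball : ∀ x (r : ℝ), 0 ≤ r → (∀ j, ‖cE x j‖ ≤ r) → ‖x‖ ≤ r)
    {u : E →L[ℂ] ell ι ∞} (hu : IsMatrixOf cE coords u a) : rowENorm a ≤ ‖u‖ₑ := by
  refine iSup_le fun i => ENNReal.summable.tsum_le_of_sum_le fun J => ?_
  choose ε hε1 hε using fun j => RCLike.exists_norm_eq_mul_self (a i j)
  set x : E := ∑ j ∈ J, ε j • e j with hx
  have hcx : ∀ j, cE x j = if j ∈ J then ε j else 0 := fun j => by
    simp [hx, he, Finset.sum_apply, Pi.single_apply]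
  have hx1 : ‖x‖ ≤ 1 := hball x 1 zero_le_one fun j => by
    rw [hcx]
    split_ifs
    · exact (hε1 j).le
    · simp
  have hux : u x i = ((∑ j ∈ J, ‖a i j‖ : ℝ) : ℂ) := by
    have h1 : HasSum (fun j => a i j * cE x j) (∑ j ∈ J, a i j * cE x j) :=
      hasSum_sum_of_ne_finset_zero fun j hj => by rw [hcx, if_neg hj, mul_zero]
    refine (hu x i).unique ?_
    convert h1 using 1
    push_cast
    refine Finset.sum_congr rfl fun j hj => ?_
    rw [hcx, if_pos hj, mul_comm, ← hε]; rfl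
  have h2 : ∑ j ∈ J, ‖a i j‖ ≤ ‖u‖ := by
    have h3 : ‖u x i‖ ≤ ‖u‖ :=
      (lp.norm_apply_le_norm (by simp) (u x) i).trans (u.unit_le_opNorm x hx1)
    rwa [hux, Complex.norm_real, Real.norm_of_nonneg (by positivity)] at h3
  rw [← ofReal_norm]
  refine le_trans (le_of_eq ?_) (ENNReal.ofReal_le_ofReal h2)
  rw [ENNReal.ofReal_sum_of_nonneg fun _ _ => norm_nonneg _]
  simp only [ofReal_norm]

/-- Common to $c_0$ and $\ell_\infty^n$: a supremum norm in which every vector is the sum of its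
coordinate expansion. -/
theorem isometricIdentity_rowENorm [DecidableEq ι] {e : ι → E}
    (hsum : ∀ x, HasSum (fun j => cE x j • e j) x) (he : ∀ j, cE (e j) = Pi.single j 1)
    (hcoord : ∀ x j, ‖cE x j‖ ≤ ‖x‖)
    (hball : ∀ x (r : ℝ), 0 ≤ r → (∀ j, ‖cE x j‖ ≤ r) → ‖x‖ ≤ r) :
    IsometricIdentity (E := E) (F := ell ι ∞) cE coords (fun u => ‖u‖ₑ) rowENorm := by
  refine ⟨fun u _ => existsUnique_isMatrixOf hsum he (exists_coordinate ι ∞) u, fun a ha => ?_,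
    fun u a hu => le_antisymm ?_ (rowENorm_le_of_isMatrixOf cE he hball hu)⟩
  · obtain ⟨u, hu, -⟩ := exists_operator_of_rowENorm_le cE hcoord (ENNReal.coe_toNNReal ha).ge
    exact ⟨u, hu, fun v hv => hv.operator_unique (coordsHom_injective ι ∞) hu⟩
  · rcases eq_or_ne (rowENorm a) ∞ with ha | ha
    · rw [ha]; exact le_top
    · obtain ⟨v, hv, hvC⟩ := exists_operator_of_rowENorm_le cE hcoord (ENNReal.coe_toNNReal ha).ge
      rw [hu.operator_unique (coordsHom_injective ι ∞) hv, ← ENNReal.coe_toNNReal ha,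
        enorm_eq_nnnorm]
      exact_mod_cast hvC

end Rows

theorem isometricIdentity_ell_top [Finite ι] :
    IsometricIdentity (E := ell ι ∞) (F := ell ι ∞) coords coords (fun u => ‖u‖ₑ) rowENorm := by
  classical
  cases nonempty_fintype ι
  refine isometricIdentity_rowENorm (coordsHom ι ∞) (e := fun j => lp.single ∞ j (1 : ℂ))
    (fun x => ?_) (coords_single (p := ∞)) (fun x j => lp.norm_apply_le_norm (by simp) x j)
    fun x r hr h => lp.norm_le_of_forall_le hr h
  have h1 := hasSum_fintype fun j => coordsHom ι ∞ x j • (lp.single ∞ j (1 : ℂ) : ell ι ∞)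
  have h2 : ∑ j, coordsHom ι ∞ x j • (lp.single ∞ j (1 : ℂ) : ell ι ∞) = x := by
    refine coordsHom_injective ι ∞ (funext fun i => ?_)
    have h3 : ∀ j, coordsHom ι ∞ (lp.single ∞ j (1 : ℂ)) = Pi.single j 1 := coords_single (p := ∞)
    rw [map_sum, Finset.sum_apply]
    simp [h3, Pi.single_apply]
  rwa [h2] at h1

theorem isometricIdentity_c_zero :
    IsometricIdentity (E := C₀(ℕ, ℂ)) (F := ell ℕ ∞) coordsZero coords
      (fun u => ‖u‖ₑ) rowENorm := by
  have hball : ∀ (x : C₀(ℕ, ℂ)) (r : ℝ), 0 ≤ r → (∀ j, ‖x j‖ ≤ r) → ‖x‖ ≤ r := by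
    intro x r hr h
    rw [← ZeroAtInftyContinuousMap.norm_toBCF_eq_norm]
    exact (BoundedContinuousFunction.norm_le hr).2 h
  set cE : C₀(ℕ, ℂ) →ₗ[ℂ] ℕ → ℂ :=
    { toFun := coordsZero
      map_add' := fun _ _ => rfl
      map_smul' := fun _ _ => rfl }
  set e : ℕ → C₀(ℕ, ℂ) := fun j =>
    { toFun := Pi.single j 1
      continuous_toFun := continuous_of_discreteTopology
      zero_at_infty' := by
        refine tendsto_const_nhds.congr' ?_
        rw [Filter.cocompact_eq_cofinite]
        filter_upwards [(Set.finite_singleton j).compl_mem_cofinite] with i hi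
        exact (Pi.single_eq_of_ne (M := fun _ => ℂ) hi 1).symm }
  have hce : ∀ j, cE (e j) = Pi.single j 1 := fun _ => rfl
  refine isometricIdentity_rowENorm cE (e := e) (fun x => ?_) hce (fun x j => ?_) hball
  · rw [HasSum, SummationFilter.unconditional_filter, Metric.tendsto_atTop]
    intro r hr
    have hx := x.zero_at_infty'
    rw [Filter.cocompact_eq_cofinite, Metric.tendsto_nhds] at hx
    -- Once `J` contains the finitely many large coordinates, the remainder has supremum norm at
    -- most $r/2$.
    have hfin : {j | ¬ dist (x j) 0 < r / 2}.Finite := hx (r / 2) (half_pos hr)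
    refine ⟨hfin.toFinset, fun J hJ => ?_⟩
    rw [dist_comm, dist_eq_norm]
    refine (hball _ (r / 2) (half_pos hr).le fun j => ?_).trans_lt (half_lt_self hr)
    have h1 : (x - ∑ i ∈ J, cE x i • e i) j = if j ∈ J then 0 else x j := by
      change cE (x - ∑ i ∈ J, cE x i • e i) j = _
      rw [map_sub, map_sum, Pi.sub_apply, Finset.sum_apply]
      simp only [map_smul, hce, Pi.smul_apply, smul_eq_mul, Pi.single_apply, mul_ite, mul_one,
        mul_zero, Finset.sum_ite_eq]
      change x j - (if j ∈ J then x j else 0) = _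
      split_ifs <;> simp
    rw [h1]
    split_ifs with hj
    · simpa using (half_pos hr).le
    · by_contra hcon
      refine hj (hJ (hfin.mem_toFinset.2 fun hlt => hcon ?_))
      rw [dist_zero_right] at hlt
      exact hlt.le
  · rw [← ZeroAtInftyContinuousMap.norm_toBCF_eq_norm]
    exact x.toBCF.norm_coe_le_norm j

/-- Exchanging the two sums, $\sum_i\sum_j|a_{ij}x_j|$ is at most $C\|x\|_1$. -/
theorem exists_operator_of_colENorm_le (h : colENorm a ≤ C) :
    ∃ u : ell ι 1 →L[ℂ] ell ι 1, IsMatrixOf coords coords u a ∧ ‖u‖ ≤ C := by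
  obtain ⟨u, hu, huC⟩ := exists_operator (coordsHom ι 1) (coordsHom ι 1) (coordsHom_injective ι 1)
    (a := a) (C := C) fun x => by
      have hle : ∑' i, ∑' j, ‖a i j * x j‖ₑ ≤ C * ‖x‖ₑ := by
        rw [ENNReal.tsum_comm, enorm_ell_one, ← ENNReal.tsum_mul_left]
        refine ENNReal.tsum_le_tsum fun j => ?_
        simp only [enorm_mul]
        rw [ENNReal.tsum_mul_right]
        gcongr
        exact (le_iSup (fun j => ∑' i, ‖a i j‖ₑ) j).trans h
      have hfin : ∑' i, ∑' j, ‖a i j * x j‖ₑ ≠ ∞ :=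
        ne_top_of_le_ne_top (ENNReal.mul_ne_top ENNReal.coe_ne_top enorm_ne_top) hle
      set y : ι → ℂ := fun i => ∑' j, a i j * x j with hy
      have hys : ∀ i, HasSum (fun j => a i j * x j) (y i) := fun i =>
        (summable_of_tsum_enorm_ne_top (ENNReal.ne_top_of_tsum_ne_top hfin i)).hasSum
      have hyle : ∑' i, ‖y i‖ₑ ≤ ∑' i, ∑' j, ‖a i j * x j‖ₑ :=
        ENNReal.tsum_le_tsum fun i => enorm_le_of_hasSum (hys i)
      have hym : Memℓp y 1 := memℓp_of_tsum_ne_top (by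
        simpa using ne_top_of_le_ne_top hfin hyle)
      refine ⟨⟨y, hym⟩, hys, ?_⟩
      have h1 : ‖(⟨y, hym⟩ : ell ι 1)‖ₑ ≤ C * ‖x‖ₑ := by
        rw [enorm_ell_one]; exact hyle.trans hle
      simp only [enorm_eq_nnnorm] at h1
      exact_mod_cast h1
  exact ⟨u, hu, u.opNorm_le_bound C.2 huC⟩

/-- The image of the $j$-th unit vector is the $j$-th column. -/
theorem colENorm_le_of_isMatrixOf {u : ell ι 1 →L[ℂ] ell ι 1}
    (hu : IsMatrixOf coords coords u a) : colENorm a ≤ ‖u‖ₑ := by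
  classical
  refine iSup_le fun j => ?_
  have h1 : ∀ i, u (lp.single 1 j 1) i = a i j := fun i => by
    refine (hu (lp.single 1 j 1) i).unique ?_
    rw [coords_single]
    have := hasSum_single (f := fun k => a i k * (Pi.single j 1 : ι → ℂ) k) j fun k hk => by
      simp [hk]
    simpa using this
  have h2 : ‖(lp.single 1 j 1 : ell ι 1)‖ ≤ 1 := by
    rw [lp.norm_single (by simp)]; simp
  have h3 : ‖u (lp.single 1 j 1)‖ ≤ ‖u‖ := u.unit_le_opNorm _ h2
  rw [← enorm_le_iff_norm_le, enorm_ell_one] at h3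
  simpa only [h1] using h3

theorem isometricIdentity_ell_one :
    IsometricIdentity (E := ell ι 1) (F := ell ι 1) coords coords (fun u => ‖u‖ₑ) colENorm := by
  classical
  refine ⟨fun u _ => existsUnique_isMatrixOf (cE := coords) (cF := coords)
    (e := fun j => lp.single 1 j (1 : ℂ)) (hasSum_coords_single (by simp)) coords_single
    (exists_coordinate ι 1) u, fun a ha => ?_,
    fun u a hu => le_antisymm ?_ (colENorm_le_of_isMatrixOf hu)⟩
  · obtain ⟨u, hu, -⟩ := exists_operator_of_colENorm_le (ENNReal.coe_toNNReal ha).ge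
    exact ⟨u, hu, fun v hv => hv.operator_unique (coordsHom_injective ι 1) hu⟩
  · rcases eq_or_ne (colENorm a) ∞ with ha | ha
    · rw [ha]; exact le_top
    · obtain ⟨v, hv, hvC⟩ := exists_operator_of_colENorm_le (ENNReal.coe_toNNReal ha).ge
      rw [hu.operator_unique (coordsHom_injective ι 1) hv, ← ENNReal.coe_toNNReal ha,
        enorm_eq_nnnorm]
      exact_mod_cast hvC

end RowAndColumnNorms

end RegInterp

end

open RegInterp in
theorem theorem1 (θ : ℝ) (hθ₀ : 0 < θ) (hθ₁ : θ < 1)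
    (p : ℝ≥0∞) [Fact (1 ≤ p)] (hp : p = ENNReal.ofReal (1 / θ)) :
    -- the identifications of `A₀ⁿ`, `A₁ⁿ`, `A₀`, `A₁` with spaces of operators
    (∀ n : ℕ, IsometricIdentity (E := ell (Fin n) ∞) (F := ell (Fin n) ∞) coords coords
        (fun u => ‖u‖ₑ) rowENorm) ∧
    (∀ n : ℕ, IsometricIdentity (E := ell (Fin n) 1) (F := ell (Fin n) 1) coords coords
        (fun u => ‖u‖ₑ) colENorm) ∧
    IsometricIdentity (E := C₀(ℕ, ℂ)) (F := ell ℕ ∞) coordsZero coords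
        (fun u => ‖u‖ₑ) rowENorm ∧
    IsometricIdentity (E := ell ℕ 1) (F := ell ℕ 1) coords coords
        (fun u => ‖u‖ₑ) colENorm ∧
    -- (i)
    (∀ n : ℕ, IsometricIdentity (E := ell (Fin n) p) (F := ell (Fin n) p) coords coords
        regENorm ((matrixCouple (Fin n)).lowerENorm θ)) ∧
    -- (ii)
    (∀ a : Matrix ℕ ℕ ℂ, productENorm ℕ θ a = (matrixCouple ℕ).upperENorm θ a) ∧
    IsometricIdentity (E := ell ℕ p) (F := ell ℕ p) coords coords
        regENorm ((matrixCouple ℕ).upperENorm θ) ∧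
    -- the regular norm is the operator norm of the matrix of absolute values
    (∀ (n : ℕ) (u : ell (Fin n) p →L[ℂ] ell (Fin n) p) (a : Matrix (Fin n) (Fin n) ℂ),
        IsMatrixOf coords coords u a → regENorm u = opENorm p (absMatrix a)) ∧
    (∀ (u : ell ℕ p →L[ℂ] ell ℕ p) (a : Matrix ℕ ℕ ℂ),
        IsMatrixOf coords coords u a → regENorm u = opENorm p (absMatrix a)) := by
  have hp' : p.toReal = θ⁻¹ := by
    rw [hp, one_div, ENNReal.toReal_ofReal (inv_nonneg.2 hθ₀.le)]
  exact ⟨fun _ => isometricIdentity_ell_top, fun _ => isometricIdentity_ell_one,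
    isometricIdentity_c_zero, isometricIdentity_ell_one,
    fun _ => isometricIdentity_regENorm hθ₀ hθ₁ hp' (lowerENorm_eq_schurENorm hθ₀ hθ₁),
    fun a => (productENorm_eq_schurENorm hθ₀ hθ₁ a).trans
      (upperENorm_eq_schurENorm hθ₀ hθ₁ a).symm,
    isometricIdentity_regENorm hθ₀ hθ₁ hp' (upperENorm_eq_schurENorm hθ₀ hθ₁),
    fun _ _ a hu => (regENorm_eq_schurENorm hθ₀ hθ₁ hp' hu).trans
      (opENorm_absMatrix_eq_schurENorm hθ₀ hθ₁ hp' a).symm,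
    fun _ a hu => (regENorm_eq_schurENorm hθ₀ hθ₁ hp' hu).trans
      (opENorm_absMatrix_eq_schurENorm hθ₀ hθ₁ hp' a).symm⟩
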